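/- Let $d\ge 1$, $\mathcal H_s=\ell^2(\{0,\dots,d-1\})$ with canonical basis $e_0,\dots,e_{d-1}$, and $\mathcal H_r=\ell^2(\mathbb Z)$ with canonical basis $(\Psi_j)_{j\in\mathbb Z}$. Let $a^\#(\cdot)$, $b^\#(\cdot)$ be the fermionic creation and annihilation operators on the antisymmetric Fock spaces $\mathcal F_-(\mathcal H_s)$ and $\mathcal F_-(\mathcal H_r)$, write $a_j^\#=a^\#(e_j)$, $b_j^\#=b^\#(\Psi_j)$, let $\mathcal B$ be the $C^*$-algebra generated by all $b(\phi),b^*(\phi)$, and let $\mathcal A$ be the algebra of all operators on $\mathcal F_-(\mathcal H_s)$. Let $W$ be an arbitrary unitary operator on $\mathcal H_s$, $S$ the shift $S\Psi_j=\Psi_{j-1}$ on $\mathcal H_r$, $\alpha\in\mathbb R$, and let $U=(\Gamma(S)\otimes\Gamma(W))\,K$ on $\mathcal F_-(\mathcal H_r)\otimes\mathcal F_-(\mathcal H_s)$, where $\Gamma$ denotes second quantization and $K=\exp[-i\alpha(b_0^*\otimes a_0+b_0\otimes a_0^*)]$; put $\tau^t(X)=U^{*t}XU^t$ for $X\in\mathcal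 B\otimes\mathcal A$, $t\in\mathbb N$. Let $0\le\sigma\le 1$ and let $\omega$ be the gauge-invariant quasi-free state on $\mathcal B$ with density $\Sigma=\sigma\mathbb I$, i.e. $\omega(b^*(\phi_m)\cdots b^*(\phi_1)b(\psi_1)\cdots b(\psi_n))=\delta_{nm}\det\{\langle\psi_j,\Sigma\phi_k\rangle\}$. Let $\rho$ be an arbitrary density matrix on $\mathcal F_-(\mathcal H_s)$, identified with the state $A\mapsto\mathrm{tr}(\rho A)$. The two-body reduced density matrix $\rho^{(2)}_t$ of the sample at time $t$ is the operator on $\mathcal H_s\wedge\mathcal H_s$ with matrix elements $$\langle e_{j_1}\wedge e_{j_2}\,|\,\rho^{(2)}_t\, e_{k_1}\wedge e_{k_2}\rangle=(\omega\otimes\rho)\big(\tau^t(\mathbb I\otimes a_{k_1}^*a_{k_2}^*a_{j_2}a_{j_1})\big),$$ where $u\wedge v=(u\otimes v-v\otimes u)/\sqrt2$. Let $\mathbb M=W\big(\mathbb I+(\cos\alpha-1)|e_0\rangle\langle e_0|\big)$ on $\mathcal H_s$ and let $P_A$ be the orthogonal projection of $\mathcal H_s\otimes\mathcal H_s$ onto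 $\mathcal H_s\wedge\mathcal H_s$. If the spectrum of $\mathbb M$ does not meet the unit circle, then $$\lim_{t\to\infty}\rho^{(2)}_t=P_A(\sigma\mathbb I\otimes\sigma\mathbb I)P_A=\sigma^2\,\mathbb I_{\mathcal H_s\wedge\mathcal H_s}$$ in norm. In particular the limit depends neither on the sample dynamics $W$, nor on the coupling constant $\alpha$, nor on the initial state $\rho$. -/

import Mathlib

open scoped TensorProduct ComplexOrder
open Filter Topology

noncomputable section

namespace FermiWalk

/-- The Hilbert space `ℓ²(ι)`. -/
abbrev Hil (ι : Type) : Type := lp (fun _ : ι => ℂ) 2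

/-- The canonical basis vectors of `ℓ²(ι)`. -/
def ket {ι : Type} [DecidableEq ι] (i : ι) : Hil ι := lp.single 2 i (1 : ℂ)

/-- The antisymmetric Fock space over `ℓ²(ι)`, `ι` linearly ordered, in the occupation number
representation: the elementary vectors `e_S = e_{s₁} ∧ ⋯ ∧ e_{s_q}` with `S = {s₁ < ⋯ < s_q}` form an
orthonormal basis, and a vector is the square summable family of its coefficients in it. -/
abbrev Fock (ι : Type) : Type := lp (fun _ : Finset ι => ℂ) 2

/-- The basis vector `e_S`; `occ ∅` is the vacuum `Ω`. -/
def occ {ι : Type} [DecidableEq ι] (S : Finset ι) : Fock ι := lp.single 2 S (1 : ℂ)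

/-- The sign of `e_i ∧ e_S = ± e_{S ∪ {i}}`: minus one to the number of elements of `S` below `i`. -/
def sgn {ι : Type} [LinearOrder ι] (i : ι) (S : Finset ι) : ℂ :=
  (-1) ^ (S.filter (· < i)).card

/-- The coordinates of `φ ∧ f`. -/
def createFun {ι : Type} [LinearOrder ι] (φ : ι → ℂ) (f : Finset ι → ℂ) (S : Finset ι) : ℂ :=
  ∑ i ∈ S, sgn i S * φ i * f (S.erase i)

theorem sgn_sq {ι : Type} [LinearOrder ι] (i : ι) (S : Finset ι) : sgn i S * sgn i S = 1 := by
  simp [sgn, ← mul_pow]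

theorem sgn_norm {ι : Type} [LinearOrder ι] (i : ι) (S : Finset ι) : ‖sgn i S‖ = 1 := by
  simp [sgn]

theorem sgn_star {ι : Type} [LinearOrder ι] (i : ι) (S : Finset ι) :
    (starRingEnd ℂ) (sgn i S) = sgn i S := by
  simp [sgn]

theorem sgn_insert {ι : Type} [LinearOrder ι] (i j : ι) (S : Finset ι) (hj : j ∉ S) :
    sgn i (insert j S) = (if j < i then -1 else 1) * sgn i S := by
  unfold sgn
  rw [Finset.filter_insert]
  split_ifs with h
  · rw [Finset.card_insert_of_notMem (by simp [hj]), pow_succ]; ring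
  · simp

theorem sgn_erase {ι : Type} [LinearOrder ι] (i j : ι) (S : Finset ι) (hj : j ∈ S) :
    sgn i (S.erase j) = (if j < i then -1 else 1) * sgn i S := by
  have := sgn_insert i j (S.erase j) (by simp)
  rw [Finset.insert_erase hj] at this
  rw [this, ← mul_assoc]; split_ifs <;> simp

theorem sq_sum_le {ι : Type} (f : Hil ι) (G : Finset ι) : ∑ i ∈ G, ‖f i‖ ^ 2 ≤ ‖f‖ ^ 2 := by
  have := lp.sum_rpow_le_norm_rpow (p := 2) (by norm_num) f G
  simpa using this

theorem memLp_of_sq {ι : Type} {f : ι → ℂ} {C : ℝ} (h : ∀ G : Finset ι, ∑ i ∈ G, ‖f i‖ ^ 2 ≤ C) :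
    Memℓp f 2 := memℓp_gen' (C := C) (by simpa using h)

theorem norm_le_of_sq {ι : Type} {f : Hil ι} {C : ℝ} (hC : 0 ≤ C)
    (h : ∀ G : Finset ι, ∑ i ∈ G, ‖f i‖ ^ 2 ≤ C ^ 2) : ‖f‖ ≤ C :=
  lp.norm_le_of_forall_sum_le (by norm_num) hC (by simpa using h)

/-- The bounded operator with a given square-summably bounded action on coordinates. -/
def mkOp {ι κ : Type} (T : (ι → ℂ) →ₗ[ℂ] (κ → ℂ)) (C : ℝ) (hC : 0 ≤ C)
    (h : ∀ (f : Hil ι) (G : Finset κ), ∑ S ∈ G, ‖T f S‖ ^ 2 ≤ (C * ‖f‖) ^ 2) :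
    Hil ι →L[ℂ] Hil κ :=
  LinearMap.mkContinuous
    { toFun := fun f => ⟨T f, memLp_of_sq (h f)⟩
      map_add' := fun f g => by
        ext S; exact congrFun (T.map_add (f : ι → ℂ) (g : ι → ℂ)) S
      map_smul' := fun c f => by
        ext S; exact congrFun (T.map_smul c (f : ι → ℂ)) S } C
    (fun f => norm_le_of_sq (by positivity) (h f))

theorem mkOp_apply {ι κ : Type} (T : (ι → ℂ) →ₗ[ℂ] (κ → ℂ)) (C : ℝ) (hC : 0 ≤ C)
    (h : ∀ (f : Hil ι) (G : Finset κ), ∑ S ∈ G, ‖T f S‖ ^ 2 ≤ (C * ‖f‖) ^ 2) (f : Hil ι) (S : κ) :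
    mkOp T C hC h f S = T f S := rfl

theorem mkOp_norm {ι κ : Type} (T : (ι → ℂ) →ₗ[ℂ] (κ → ℂ)) (C : ℝ) (hC : 0 ≤ C)
    (h : ∀ (f : Hil ι) (G : Finset κ), ∑ S ∈ G, ‖T f S‖ ^ 2 ≤ (C * ‖f‖) ^ 2) :
    ‖mkOp T C hC h‖ ≤ C := LinearMap.mkContinuous_norm_le _ hC _

/-- `createFun` as a linear map. -/
def createLin {ι : Type} [LinearOrder ι] (φ : ι → ℂ) : (Finset ι → ℂ) →ₗ[ℂ] (Finset ι → ℂ) where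
  toFun f := createFun φ f
  map_add' f g := by
    ext S; simp [createFun, mul_add, Finset.sum_add_distrib]
  map_smul' c f := by
    ext S; simp only [createFun, Pi.smul_apply, smul_eq_mul, RingHom.id_apply, Finset.mul_sum]
    exact Finset.sum_congr rfl fun i _ => by ring

theorem createFun_single {ι : Type} [LinearOrder ι] (i : ι) (f : Finset ι → ℂ) (S : Finset ι) :
    createFun (Pi.single i 1) f S = if i ∈ S then sgn i S * f (S.erase i) else 0 := by
  unfold createFun
  by_cases h : i ∈ S
  · rw [if_pos h, Finset.sum_eq_single_of_mem i h]
    · simp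
    · intro j _ hj; simp [hj]
  · rw [if_neg h]
    refine Finset.sum_eq_zero fun j hj => ?_
    have : j ≠ i := fun e => h (e ▸ hj)
    simp [this]

theorem create_single_bound {ι : Type} [LinearOrder ι] (i : ι) (f : Fock ι)
    (G : Finset (Finset ι)) :
    ∑ S ∈ G, ‖createLin (Pi.single i 1) f S‖ ^ 2 ≤ (1 * ‖f‖) ^ 2 := by
  have h1 : ∀ S ∈ G, ‖createLin (Pi.single i 1) f S‖ ^ 2
      = if i ∈ S then ‖f (S.erase i)‖ ^ 2 else 0 := by
    intro S _
    change ‖createFun (Pi.single i 1) f S‖ ^ 2 = _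
    rw [createFun_single]
    split_ifs <;> simp [sgn_norm]
  rw [Finset.sum_congr rfl h1, ← Finset.sum_filter, one_mul]
  have h2 : Set.InjOn (fun S : Finset ι => S.erase i) (G.filter (i ∈ ·)) := by
    intro S hS T hT h
    have hS' : i ∈ S := by simpa using (Finset.mem_filter.1 hS).2
    have hT' : i ∈ T := by simpa using (Finset.mem_filter.1 hT).2
    change S.erase i = T.erase i at h
    rw [← Finset.insert_erase hS', h, Finset.insert_erase hT']
  rw [← Finset.sum_image (f := fun T => ‖f T‖ ^ 2) h2]
  exact sq_sum_le f _

/-- Creation operator of the `i`-th basis vector (auxiliary). -/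
def cst {ι : Type} [LinearOrder ι] (i : ι) : Fock ι →L[ℂ] Fock ι :=
  mkOp (createLin (Pi.single i 1)) 1 zero_le_one (create_single_bound i)

theorem cst_apply {ι : Type} [LinearOrder ι] (i : ι) (f : Fock ι) (S : Finset ι) :
    cst i f S = if i ∈ S then sgn i S * f (S.erase i) else 0 := by
  rw [cst, mkOp_apply]; exact createFun_single i f S

theorem occ_apply {ι : Type} [DecidableEq ι] (S T : Finset ι) :
    occ S T = if T = S then 1 else 0 := by
  simp [occ, Pi.single_apply]

theorem occ_inner {ι : Type} [DecidableEq ι] (S : Finset ι) (f : Fock ι) :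
    inner ℂ (occ S) f = f S := by
  rw [occ, lp.inner_single_left]; simp

theorem cst_occ {ι : Type} [LinearOrder ι] (i : ι) (S : Finset ι) :
    cst i (occ S) = if i ∈ S then 0 else sgn i S • occ (insert i S) := by
  ext T
  rw [cst_apply]
  by_cases hS : i ∈ S
  · rw [if_pos hS]
    split_ifs with hT
    · have : T.erase i ≠ S := by rintro rfl; simp at hS
      simp [occ_apply, this]
    · simp
  · rw [if_neg hS]
    by_cases hT : i ∈ T
    · rw [if_pos hT]
      by_cases h : T = insert i S
      · subst h
        rw [Finset.erase_insert hS, sgn_insert i i S hS]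
        simp [occ_apply]
      · have : T.erase i ≠ S := by rintro rfl; exact h (Finset.insert_erase hT).symm
        simp [occ_apply, this, h]
    · rw [if_neg hT]
      have : T ≠ insert i S := by rintro rfl; simp at hT
      simp [occ_apply, this]

theorem cann_apply {ι : Type} [LinearOrder ι] (i : ι) (f : Fock ι) (S : Finset ι) :
    star (cst i) f S = if i ∈ S then 0 else sgn i S * f (insert i S) := by
  rw [← occ_inner, ContinuousLinearMap.star_eq_adjoint, ContinuousLinearMap.adjoint_inner_right,
    cst_occ]
  split_ifs
  · simp
  · rw [inner_smul_left, occ_inner, sgn_star]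

theorem car_basis {ι : Type} [LinearOrder ι] (i j : ι) :
    star (cst i) * cst j + cst j * star (cst i) = if i = j then 1 else 0 := by
  ext f S
  have key : ((star (cst i) * cst j + cst j * star (cst i)) f) S
    = (star (cst i)) (cst j f) S + cst j (star (cst i) f) S := rfl
  rw [key, cann_apply, cst_apply, cst_apply, cann_apply]
  by_cases hij : i = j
  · subst hij
    by_cases hi : i ∈ S
    · simp [hi, Finset.insert_erase hi, sgn_erase i i S hi, ← mul_assoc, sgn_sq]
    · simp [hi, Finset.erase_insert hi, sgn_insert i i S hi, ← mul_assoc, sgn_sq]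
  · rw [if_neg hij]
    by_cases hi : i ∈ S <;> by_cases hj : j ∈ S
    · simp [hi, hj, hij]
    · simp [hi, hj]
    · have e : (insert i S).erase j = insert i (S.erase j) := by
        rw [Finset.erase_insert_of_ne hij]
      rw [if_neg hi, if_pos (by simp [hj]), if_pos hj, if_neg (by simp [hi]), e,
        sgn_insert j i S hi, sgn_erase i j S hj]
      rcases lt_or_gt_of_ne hij with h | h
      · simp [h, h.not_gt]; ring
      · simp [h, h.not_gt]; ring
    · simp [hi, hj, Ne.symm hij]

theorem cst_anti {ι : Type} [LinearOrder ι] (i j : ι) :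
    cst i * cst j + cst j * cst i = 0 := by
  ext f S
  have key : ((cst i * cst j + cst j * cst i) f) S
    = cst i (cst j f) S + cst j (cst i f) S := rfl
  rw [key, cst_apply, cst_apply, cst_apply, cst_apply]
  by_cases hij : i = j
  · subst hij; simp
  · by_cases hi : i ∈ S <;> by_cases hj : j ∈ S
    · rw [if_pos hi, if_pos hj, if_pos (by simp [hj, Ne.symm hij]), if_pos (by simp [hi, hij]),
        Finset.erase_right_comm, sgn_erase j i S hi, sgn_erase i j S hj]
      rcases lt_or_gt_of_ne hij with h | h
      · simp [h, h.not_gt]; ring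
      · simp [h, h.not_gt]; ring
    all_goals simp [hi, hj]

theorem cst_comb_norm {ι : Type} [LinearOrder ι] (φ : ι → ℂ) (Λ : Finset ι) (f : Fock ι) :
    ‖(∑ i ∈ Λ, φ i • cst i) f‖ ^ 2 ≤ (∑ i ∈ Λ, ‖φ i‖ ^ 2) * ‖f‖ ^ 2 := by
  set A := ∑ i ∈ Λ, φ i • cst i with hA
  have hcar : star A * A + A * star A = ((∑ i ∈ Λ, ‖φ i‖ ^ 2 : ℝ) : ℂ) • 1 := by
    have hs : star A = ∑ i ∈ Λ, (starRingEnd ℂ) (φ i) • star (cst i) := by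
      rw [hA, star_sum]; exact Finset.sum_congr rfl fun i _ => by rw [star_smul]; rfl
    rw [hs, hA, Finset.sum_mul_sum, Finset.sum_mul_sum, Finset.sum_comm (s := Λ) (t := Λ)
      (f := fun i j => (φ i • cst i) * ((starRingEnd ℂ) (φ j) • star (cst j))),
      ← Finset.sum_add_distrib]
    have : ∀ i ∈ Λ, (∑ j ∈ Λ, ((starRingEnd ℂ) (φ i) • star (cst i)) * (φ j • cst j)
        + ∑ j ∈ Λ, (φ j • cst j) * ((starRingEnd ℂ) (φ i) • star (cst i)))
        = ((‖φ i‖ ^ 2 : ℝ) : ℂ) • (1 : Fock ι →L[ℂ] Fock ι) := by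
      intro i hi
      rw [← Finset.sum_add_distrib]
      have : ∀ j ∈ Λ, ((starRingEnd ℂ) (φ i) • star (cst i)) * (φ j • cst j)
        + (φ j • cst j) * ((starRingEnd ℂ) (φ i) • star (cst i))
        = ((starRingEnd ℂ) (φ i) * φ j) • (if i = j then (1 : Fock ι →L[ℂ] Fock ι) else 0) := by
        intro j _
        rw [← car_basis, smul_mul_smul_comm, smul_mul_smul_comm, smul_add, mul_comm (φ j)]
      rw [Finset.sum_congr rfl this, Finset.sum_eq_single_of_mem i hi]
      · rw [if_pos rfl, Complex.conj_mul']; push_cast; rfl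
      · intro j _ hj; rw [if_neg (Ne.symm hj), smul_zero]
    rw [Finset.sum_congr rfl this, ← Finset.sum_smul]; push_cast; rfl
  have h1 : inner ℂ f ((star A * A + A * star A) f)
      = ((‖A f‖ ^ 2 + ‖star A f‖ ^ 2 : ℝ) : ℂ) := by
    have e : (star A * A + A * star A) f = star A (A f) + A (star A f) := rfl
    rw [e, inner_add_right, ContinuousLinearMap.star_eq_adjoint,
      ContinuousLinearMap.adjoint_inner_right,
      ← ContinuousLinearMap.adjoint_inner_left A (ContinuousLinearMap.adjoint A f) f, inner_self_eq_norm_sq_to_K, inner_self_eq_norm_sq_to_K]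
    push_cast; rfl
  rw [hcar] at h1
  have h2 : inner ℂ f ((((∑ i ∈ Λ, ‖φ i‖ ^ 2 : ℝ) : ℂ) • (1 : Fock ι →L[ℂ] Fock ι)) f)
      = (((∑ i ∈ Λ, ‖φ i‖ ^ 2) * ‖f‖ ^ 2 : ℝ) : ℂ) := by
    rw [_root_.smul_apply, one_apply_eq_self, inner_smul_right,
      inner_self_eq_norm_sq_to_K]
    push_cast; rfl
  rw [h2] at h1
  have h3 := Complex.ofReal_injective h1
  nlinarith [sq_nonneg ‖star A f‖]

theorem comb_apply {ι : Type} [LinearOrder ι] (φ : ι → ℂ) (Λ : Finset ι) (f : Fock ι)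
    (S : Finset ι) (hS : S ⊆ Λ) : (∑ i ∈ Λ, φ i • cst i) f S = createFun φ f S := by
  have : (∑ i ∈ Λ, φ i • cst i) f S = ∑ i ∈ Λ, φ i * cst i f S := by
    rw [_root_.sum_apply, lp.coeFn_sum, Finset.sum_apply]; rfl
  rw [this, createFun, ← Finset.sum_subset hS]
  · refine Finset.sum_congr rfl fun i hi => ?_
    rw [cst_apply, if_pos hi]; ring
  · intro i _ hi
    rw [cst_apply, if_neg hi, mul_zero]

theorem create_bound {ι : Type} [LinearOrder ι] (φ : Hil ι) (f : Fock ι)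
    (G : Finset (Finset ι)) :
    ∑ S ∈ G, ‖createLin φ f S‖ ^ 2 ≤ (‖φ‖ * ‖f‖) ^ 2 := by
  set Λ := G.biUnion id
  have h : ∀ S ∈ G, ‖createLin φ f S‖ ^ 2 = ‖(∑ i ∈ Λ, φ i • cst i) f S‖ ^ 2 := by
    intro S hS
    have e := comb_apply φ Λ f S (Finset.subset_biUnion_of_mem id hS)
    rw [e]; rfl
  rw [Finset.sum_congr rfl h]
  refine (sq_sum_le _ G).trans ((cst_comb_norm _ _ _).trans ?_)
  rw [mul_pow]
  gcongr
  exact sq_sum_le φ Λ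

/-- The creation operator `c*(φ)`, `f ↦ φ ∧ f`; in coordinates
`(c*(φ) f)(S) = ∑_{i ∈ S} ± φ(i) f(S \ {i})`. It is bounded, of norm at most `‖φ‖`. -/
def create {ι : Type} [LinearOrder ι] (φ : Hil ι) : Fock ι →L[ℂ] Fock ι :=
  mkOp (createLin φ) ‖φ‖ (norm_nonneg _) (create_bound φ)

theorem create_apply {ι : Type} [LinearOrder ι] (φ : Hil ι) (f : Fock ι) (S : Finset ι) :
    create φ f S = ∑ i ∈ S, sgn i S * φ i * f (S.erase i) := rfl

/-- The annihilation operator `c(φ)`, the adjoint of `c*(φ)`. -/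
def annih {ι : Type} [LinearOrder ι] (φ : Hil ι) : Fock ι →L[ℂ] Fock ι :=
  star (create φ)

theorem create_ket {ι : Type} [LinearOrder ι] (i : ι) : create (ket i) = cst i := rfl

theorem create_add {ι : Type} [LinearOrder ι] (φ ψ : Hil ι) :
    create (φ + ψ) = create φ + create ψ := by
  ext f S
  change create (φ + ψ) f S = create φ f S + create ψ f S
  rw [create_apply, create_apply, create_apply, ← Finset.sum_add_distrib]
  refine Finset.sum_congr rfl fun i _ => ?_
  rw [lp.coeFn_add, Pi.add_apply]; ring

theorem create_smul {ι : Type} [LinearOrder ι] (c : ℂ) (φ : Hil ι) :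
    create (c • φ) = c • create φ := by
  ext f S
  change create (c • φ) f S = c * create φ f S
  rw [create_apply, create_apply, Finset.mul_sum]
  refine Finset.sum_congr rfl fun i _ => ?_
  rw [lp.coeFn_smul, Pi.smul_apply, smul_eq_mul]; ring

/-- The linear dependence of `c*(φ)` on `φ`. -/
def createL {ι : Type} [LinearOrder ι] : Hil ι →L[ℂ] (Fock ι →L[ℂ] Fock ι) :=
  LinearMap.mkContinuous
    { toFun := create, map_add' := create_add, map_smul' := create_smul } 1
    (fun φ => by rw [one_mul]; exact mkOp_norm _ _ (norm_nonneg φ) (create_bound φ))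

theorem create_continuous {ι : Type} [LinearOrder ι] : Continuous (create (ι := ι)) :=
  (createL (ι := ι)).continuous

theorem annih_continuous {ι : Type} [LinearOrder ι] : Continuous (annih (ι := ι)) :=
  continuous_star.comp create_continuous

/-- A closed linear condition on `ℓ²(ι)` holds everywhere if it holds on the canonical basis. -/
theorem hil_induction {ι : Type} [DecidableEq ι] {p : Hil ι → Prop} (hc : IsClosed {φ | p φ})
    (h0 : p 0) (hadd : ∀ φ ψ, p φ → p ψ → p (φ + ψ)) (hsmul : ∀ (c : ℂ) φ, p φ → p (c • φ))
    (hket : ∀ i, p (ket i)) (φ : Hil ι) : p φ := by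
  have h := lp.hasSum_single (p := 2) (by norm_num) φ
  refine hc.mem_of_tendsto h (Eventually.of_forall fun s => ?_)
  change p _
  induction s using Finset.induction_on with
  | empty => simpa using h0
  | insert a s ha ih =>
    rw [Finset.sum_insert ha]
    refine hadd _ _ ?_ ih
    have e : lp.single 2 a (φ a : ℂ) = (φ a) • (ket a : Hil ι) := by
      rw [ket, ← lp.single_smul]; simp
    rw [e]
    exact hsmul _ _ (hket a)

theorem ket_inner {ι : Type} [DecidableEq ι] (i : ι) (φ : Hil ι) : inner ℂ (ket i) φ = φ i := by
  rw [ket, lp.inner_single_left]; simp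

theorem ket_inner_ket {ι : Type} [DecidableEq ι] (i j : ι) :
    inner ℂ (ket i) (ket j) = if i = j then (1 : ℂ) else 0 := by
  rw [ket_inner, ket, lp.single_apply, Pi.single_apply]

/-- Canonical anticommutation relation `{c(φ), c*(ψ)} = ⟨φ, ψ⟩`. -/
theorem car {ι : Type} [LinearOrder ι] (φ ψ : Hil ι) :
    annih φ * create ψ + create ψ * annih φ = (inner ℂ φ ψ : ℂ) • 1 := by
  revert φ
  refine hil_induction ?_ ?_ ?_ ?_ ?_
  · exact isClosed_eq (by have := annih_continuous (ι := ι); fun_prop) (by fun_prop)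
  · have : annih (0 : Hil ι) = 0 := by
      rw [annih, ← zero_smul ℂ (0 : Hil ι), create_smul, zero_smul, star_zero]
    simp [this]
  · intro a b ha hb
    have : annih (a + b) = annih a + annih b := by simp [annih, create_add]
    rw [this, inner_add_left, add_smul, ← ha, ← hb, add_mul, mul_add]; abel
  · intro c a ha
    have : annih (c • a) = (starRingEnd ℂ c) • annih a := by
      rw [annih, create_smul, star_smul]; rfl
    rw [this, inner_smul_left, mul_smul, ← ha, smul_mul_assoc, mul_smul_comm, smul_add]
  · intro i
    revert ψ
    refine hil_induction ?_ ?_ ?_ ?_ ?_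
    · exact isClosed_eq (by have := create_continuous (ι := ι); fun_prop) (by fun_prop)
    · have : create (0 : Hil ι) = 0 := by
        rw [← zero_smul ℂ (0 : Hil ι), create_smul, zero_smul]
      simp [this]
    · intro a b ha hb
      rw [create_add, inner_add_right, add_smul, ← ha, ← hb, add_mul, mul_add]; abel
    · intro c a ha
      rw [create_smul, inner_smul_right, mul_smul, ← ha, smul_mul_assoc, mul_smul_comm, smul_add]
    · intro j
      rw [ket_inner_ket, annih, create_ket, create_ket, car_basis]
      split_ifs <;> simp

/-- Canonical anticommutation relation `{c*(φ), c*(ψ)} = 0`. -/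
theorem create_anti {ι : Type} [LinearOrder ι] (φ ψ : Hil ι) :
    create φ * create ψ + create ψ * create φ = 0 := by
  have z : create (0 : Hil ι) = 0 := by
    rw [← zero_smul ℂ (0 : Hil ι), create_smul, zero_smul]
  revert φ
  refine hil_induction ?_ ?_ ?_ ?_ ?_
  · exact isClosed_eq (by have := create_continuous (ι := ι); fun_prop) (by fun_prop)
  · simp [z]
  · intro a b ha hb
    rw [create_add, add_mul, mul_add, ← add_zero (0 : Fock ι →L[ℂ] Fock ι)]
    nth_rewrite 1 [← ha]
    rw [← hb]; abel
  · intro c a ha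
    rw [create_smul, smul_mul_assoc, mul_smul_comm, ← smul_add, ha, smul_zero]
  · intro i
    revert ψ
    refine hil_induction ?_ ?_ ?_ ?_ ?_
    · exact isClosed_eq (by have := create_continuous (ι := ι); fun_prop) (by fun_prop)
    · simp [z]
    · intro a b ha hb
      rw [create_add, add_mul, mul_add, ← add_zero (0 : Fock ι →L[ℂ] Fock ι)]
      nth_rewrite 1 [← ha]
      rw [← hb]; abel
    · intro c a ha
      rw [create_smul, smul_mul_assoc, mul_smul_comm, ← smul_add, ha, smul_zero]
    · intro j
      rw [create_ket, create_ket, cst_anti]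

theorem annih_vacuum {ι : Type} [LinearOrder ι] (φ : Hil ι) : annih φ (occ ∅) = 0 := by
  ext S
  rw [← occ_inner, annih, ContinuousLinearMap.star_eq_adjoint,
    ContinuousLinearMap.adjoint_inner_right, ← inner_conj_symm, occ_inner, create_apply]
  simp

/-- The elementary vector `u_{s₁} ∧ ⋯ ∧ u_{s_q} = c*(u_{s₁}) ⋯ c*(u_{s_q}) Ω`,
`S = {s₁ < ⋯ < s_q}`. -/
def wedge {ι : Type} [LinearOrder ι] (u : ι → Hil ι) (S : Finset ι) : Fock ι :=
  ((S.sort (· ≤ ·)).map fun i => create (u i)).prod (occ ∅)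

theorem wedge_empty {ι : Type} [LinearOrder ι] (u : ι → Hil ι) : wedge u ∅ = occ ∅ := by
  simp [wedge]

theorem wedge_insert {ι : Type} [LinearOrder ι] (u : ι → Hil ι) (a : ι) (S : Finset ι)
    (h : ∀ x ∈ S, a < x) : wedge u (insert a S) = create (u a) (wedge u S) := by
  have ha : a ∉ S := fun h' => lt_irrefl _ (h a h')
  rw [wedge, Finset.sort_insert _ (fun b hb => (h b hb).le) ha, List.map_cons, List.prod_cons]
  rfl

theorem annih_wedge {ι : Type} [LinearOrder ι] {u : ι → Hil ι} (hu : Orthonormal ℂ u) (i : ι)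
    (S : Finset ι) (hi : i ∉ S) : annih (u i) (wedge u S) = 0 := by
  induction S using Finset.induction_on_min with
  | empty => rw [wedge_empty, annih_vacuum]
  | insert a S h ih =>
    rw [Finset.mem_insert, not_or] at hi
    rw [wedge_insert u a S h]
    have e := congrArg (fun A : Fock ι →L[ℂ] Fock ι => A (wedge u S)) (car (u i) (u a))
    have e' : annih (u i) (create (u a) (wedge u S)) + create (u a) (annih (u i) (wedge u S))
      = (inner ℂ (u i) (u a) : ℂ) • wedge u S := e
    rw [ih hi.2, map_zero, add_zero, hu.2 hi.1, zero_smul] at e'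
    exact e'

theorem create_wedge_mem {ι : Type} [LinearOrder ι] (u : ι → Hil ι) (i : ι)
    (S : Finset ι) (hi : i ∈ S) : create (u i) (wedge u S) = 0 := by
  induction S using Finset.induction_on_min with
  | empty => simp at hi
  | insert a S h ih =>
    rw [wedge_insert u a S h]
    have e := congrArg (fun A : Fock ι →L[ℂ] Fock ι => A (wedge u S)) (create_anti (u i) (u a))
    have e' : create (u i) (create (u a) (wedge u S)) + create (u a) (create (u i) (wedge u S))
      = 0 := e
    rcases Finset.mem_insert.1 hi with rfl | hi
    · rw [← two_smul ℂ] at e'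
      simpa using e'
    · rw [ih hi, map_zero, add_zero] at e'
      exact e'

theorem create_wedge {ι : Type} [LinearOrder ι] (u : ι → Hil ι) (i : ι)
    (S : Finset ι) (hi : i ∉ S) :
    create (u i) (wedge u S) = sgn i S • wedge u (insert i S) := by
  induction S using Finset.induction_on_min with
  | empty => rw [wedge_insert u i ∅ (by simp)]; simp [sgn]
  | insert a S h ih =>
    have ha : a ∉ S := fun h' => lt_irrefl _ (h a h')
    rw [Finset.mem_insert, not_or] at hi
    rw [sgn_insert i a S ha]
    rcases lt_or_gt_of_ne hi.1 with hlt | hlt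
    · have hmin : ∀ x ∈ insert a S, i < x := by
        intro x hx
        rcases Finset.mem_insert.1 hx with rfl | hx
        · exact hlt
        · exact hlt.trans (h x hx)
      have hs : sgn i S = 1 := by
        have : S.filter (· < i) = ∅ :=
          Finset.filter_eq_empty_iff.2 fun x hx => (hlt.trans (h x hx)).not_gt
        simp [sgn, this]
      rw [wedge_insert u i _ hmin, if_neg hlt.not_gt, hs]; simp
    · have hmin : ∀ x ∈ insert i S, a < x := by
        intro x hx
        rcases Finset.mem_insert.1 hx with rfl | hx
        · exact hlt
        · exact h x hx
      rw [wedge_insert u a S h, Finset.insert_comm, wedge_insert u a _ hmin, if_pos hlt]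
      have e := congrArg (fun A : Fock ι →L[ℂ] Fock ι => A (wedge u S)) (create_anti (u i) (u a))
      have e' : create (u i) (create (u a) (wedge u S)) + create (u a) (create (u i) (wedge u S))
        = 0 := e
      rw [ih hi.2, map_smul] at e'
      rw [eq_neg_of_add_eq_zero_left e']; simp

theorem wedge_orthonormal {ι : Type} [LinearOrder ι] {u : ι → Hil ι} (hu : Orthonormal ℂ u) :
    Orthonormal ℂ (wedge u) := by
  have split : ∀ (i : ι) (x y : Fock ι), inner ℂ x y
      = inner ℂ (create (u i) x) (create (u i) y) + inner ℂ (annih (u i) x) (annih (u i) y) := by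
    intro i x y
    have e := congrArg (fun A : Fock ι →L[ℂ] Fock ι => A y) (car (u i) (u i))
    have e' : annih (u i) (create (u i) y) + create (u i) (annih (u i) y)
      = (inner ℂ (u i) (u i) : ℂ) • y := e
    have h1 : (inner ℂ (u i) (u i) : ℂ) = 1 := by
      rw [inner_self_eq_norm_sq_to_K, hu.1 i]; simp
    rw [h1, one_smul] at e'
    conv_lhs => rw [← e']
    rw [inner_add_right]
    simp only [annih, ContinuousLinearMap.star_eq_adjoint, ContinuousLinearMap.adjoint_inner_right]
    rw [← ContinuousLinearMap.adjoint_inner_right (create (u i))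
        (ContinuousLinearMap.adjoint (create (u i)) x) y,
      ContinuousLinearMap.adjoint_inner_left (create (u i))
        (ContinuousLinearMap.adjoint (create (u i)) y) x]
  constructor
  · intro S
    induction S using Finset.induction_on_min with
    | empty => rw [wedge_empty, occ, lp.norm_single (by norm_num)]; simp
    | insert a S h ih =>
      have ha : a ∉ S := fun h' => lt_irrefl _ (h a h')
      have e := split a (wedge u S) (wedge u S)
      rw [annih_wedge hu a S ha, inner_zero_left, add_zero, inner_self_eq_norm_sq_to_K,
        inner_self_eq_norm_sq_to_K, ih, ← wedge_insert u a S h] at e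
      have e2 : ‖wedge u (insert a S)‖ ^ 2 = 1 := by
        have : ((‖wedge u (insert a S)‖ ^ 2 : ℝ) : ℂ) = ((1 : ℝ) : ℂ) := by
          rw [Complex.ofReal_pow]; refine Eq.trans e.symm ?_; simp
        exact Complex.ofReal_injective this
      nlinarith [norm_nonneg (wedge u (insert a S))]
  · intro S T hST
    have : ∃ i, ¬ (i ∈ S ↔ i ∈ T) := by
      by_contra hc; push Not at hc; exact hST (Finset.ext hc)
    obtain ⟨i, hi⟩ := this
    rw [split i]
    by_cases hS : i ∈ S
    · have hT : i ∉ T := fun h => hi (by simp [hS, h])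
      rw [create_wedge_mem u i S hS, annih_wedge hu i T hT]; simp
    · have hT : i ∈ T := by by_contra h; exact hi (by simp [hS, h])
      rw [create_wedge_mem u i T hT, annih_wedge hu i S hS]; simp

theorem ket_orthonormal {ι : Type} [DecidableEq ι] : Orthonormal ℂ (ket (ι := ι)) := by
  rw [orthonormal_iff_ite]; exact ket_inner_ket

/-- Second quantization `Γ(W)` of a unitary `W`: the operator on the Fock space that maps
`e_{s₁} ∧ ⋯ ∧ e_{s_q}` to `W e_{s₁} ∧ ⋯ ∧ W e_{s_q}` and `Ω` to `Ω`. -/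
def secondQuant {ι : Type} [LinearOrder ι] (W : Hil ι ≃ₗᵢ[ℂ] Hil ι) : Fock ι →L[ℂ] Fock ι :=
  (wedge_orthonormal
    (ket_orthonormal.comp_linearIsometryEquiv W)).orthogonalFamily.linearIsometry.toContinuousLinearMap


theorem secondQuant_isom {ι : Type} [LinearOrder ι] (W : Hil ι ≃ₗᵢ[ℂ] Hil ι) :
    star (secondQuant W) * secondQuant W = 1 := by
  rw [ContinuousLinearMap.star_eq_adjoint]
  exact (ContinuousLinearMap.norm_map_iff_adjoint_comp_self _).1 (LinearIsometry.norm_map _)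

theorem secondQuant_occ {ι : Type} [LinearOrder ι] (W : Hil ι ≃ₗᵢ[ℂ] Hil ι) (S : Finset ι) :
    secondQuant W (occ S) = wedge (fun i => W (ket i)) S := by
  have hu : Orthonormal ℂ (fun i => W (ket i)) := ket_orthonormal.comp_linearIsometryEquiv W
  have e := (wedge_orthonormal hu).orthogonalFamily.linearIsometry_apply_single (i := S) (1 : ℂ)
  refine e.trans ?_
  simp

theorem fock_ext {ι : Type} [DecidableEq ι] {A B : Fock ι →L[ℂ] Fock ι}
    (h : ∀ S, A (occ S) = B (occ S)) : A = B := by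
  refine ContinuousLinearMap.ext fun f => ?_
  revert f
  refine hil_induction (p := fun f => A f = B f) ?_ ?_ ?_ ?_ h
  · exact isClosed_eq (by fun_prop) (by fun_prop)
  · simp
  · intro f g hf hg; rw [map_add, map_add, hf, hg]
  · intro c f hf; rw [map_smul, map_smul, hf]

theorem secondQuant_create {ι : Type} [LinearOrder ι] (W : Hil ι ≃ₗᵢ[ℂ] Hil ι) (φ : Hil ι) :
    secondQuant W * create φ = create (W φ) * secondQuant W := by
  revert φ
  refine hil_induction ?_ ?_ ?_ ?_ ?_
  · have := create_continuous (ι := ι)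
    have hW : Continuous fun φ : Hil ι => create (W φ) := this.comp W.continuous
    exact isClosed_eq (by fun_prop) (by fun_prop)
  · have z : create (0 : Hil ι) = 0 := by
      rw [← zero_smul ℂ (0 : Hil ι), create_smul, zero_smul]
    simp [z]
  · intro a b ha hb
    rw [map_add, create_add, create_add, mul_add, add_mul, ha, hb]
  · intro c a ha
    rw [map_smul, create_smul, create_smul, mul_smul_comm, smul_mul_assoc, ha]
  · intro i
    refine fock_ext fun S => ?_
    change secondQuant W (create (ket i) (occ S))
      = create (W (ket i)) (secondQuant W (occ S))
    rw [create_ket, cst_occ, secondQuant_occ]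
    split_ifs with h
    · rw [map_zero, create_wedge_mem (fun i => W (ket i)) i S h]
    · rw [map_smul, secondQuant_occ, create_wedge (fun i => W (ket i)) i S h]

/-- `e_S = e_{s₁} ∧ ⋯ ∧ e_{s_q}`. -/
theorem wedge_ket {ι : Type} [LinearOrder ι] (S : Finset ι) : wedge ket S = occ S := by
  induction S using Finset.induction_on_min with
  | empty => exact wedge_empty _
  | insert a S h ih =>
    have ha : a ∉ S := fun h' => lt_irrefl _ (h a h')
    have hs : sgn a S = 1 := by
      have : S.filter (· < a) = ∅ := Finset.filter_eq_empty_iff.2 fun x hx => (h x hx).not_gt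
      simp [sgn, this]
    rw [wedge_insert _ _ _ h, ih, create_ket, cst_occ, if_neg ha, hs, one_smul]

theorem secondQuant_wedge {ι : Type} [LinearOrder ι] (W : Hil ι ≃ₗᵢ[ℂ] Hil ι) (u : ι → Hil ι)
    (S : Finset ι) : secondQuant W (wedge u S) = wedge (fun i => W (u i)) S := by
  induction S using Finset.induction_on_min with
  | empty => rw [wedge_empty, wedge_empty, secondQuant_occ, wedge_empty]
  | insert a S h ih =>
    rw [wedge_insert _ _ _ h, wedge_insert _ _ _ h, ← ih]
    exact congrArg (fun A : Fock ι →L[ℂ] Fock ι => A (wedge u S)) (secondQuant_create W (u a))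

theorem secondQuant_symm {ι : Type} [LinearOrder ι] (W : Hil ι ≃ₗᵢ[ℂ] Hil ι) :
    secondQuant W * secondQuant W.symm = 1 := by
  refine fock_ext fun S => ?_
  change secondQuant W (secondQuant W.symm (occ S)) = occ S
  rw [secondQuant_occ, secondQuant_wedge]
  simp [wedge_ket]

theorem secondQuant_star {ι : Type} [LinearOrder ι] (W : Hil ι ≃ₗᵢ[ℂ] Hil ι) :
    star (secondQuant W) = secondQuant W.symm := by
  rw [← mul_one (star (secondQuant W)), ← secondQuant_symm W, ← mul_assoc, secondQuant_isom,
    one_mul]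

/-- The C⋆-algebra generated by all creation and annihilation operators. -/
def carAlg (ι : Type) [LinearOrder ι] : StarSubalgebra ℂ (Fock ι →L[ℂ] Fock ι) :=
  (StarAlgebra.adjoin ℂ (Set.range (annih (ι := ι)))).topologicalClosure

theorem annih_mem {ι : Type} [LinearOrder ι] (φ : Hil ι) : annih φ ∈ carAlg ι :=
  StarSubalgebra.le_topologicalClosure _ (StarAlgebra.subset_adjoin ℂ _ ⟨φ, rfl⟩)

theorem carAlg_isClosed (ι : Type) [LinearOrder ι] :
    IsClosed (carAlg ι : Set (Fock ι →L[ℂ] Fock ι)) :=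
  StarSubalgebra.isClosed_topologicalClosure _

theorem carAlg_conj {ι : Type} [LinearOrder ι] (W : Hil ι ≃ₗᵢ[ℂ] Hil ι)
    {X : Fock ι →L[ℂ] Fock ι} (hX : X ∈ carAlg ι) :
    star (secondQuant W) * X * secondQuant W ∈ carAlg ι := by
  have hgen : ∀ φ : Hil ι, star (secondQuant W) * create φ * secondQuant W
      = create (W.symm φ) := by
    intro φ
    rw [secondQuant_star, secondQuant_create, mul_assoc]
    have := secondQuant_symm W.symm
    rw [LinearIsometryEquiv.symm_symm] at this
    rw [this, mul_one]
  have hunit : secondQuant W * star (secondQuant W) = 1 := by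
    rw [secondQuant_star, secondQuant_symm]
  have hcl : IsClosed {X | star (secondQuant W) * X * secondQuant W ∈ carAlg ι} :=
    (carAlg_isClosed ι).preimage (by fun_prop)
  refine closure_minimal ?_ hcl hX
  intro Y hY
  change Y ∈ StarAlgebra.adjoin ℂ _ at hY
  change star (secondQuant W) * Y * secondQuant W ∈ carAlg ι
  induction hY using StarAlgebra.adjoin_induction with
  | mem x hx =>
    obtain ⟨φ, rfl⟩ := hx
    have e : star (secondQuant W) * annih φ * secondQuant W = annih (W.symm φ) := by
      rw [annih, annih, ← hgen]; simp [mul_assoc]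
    rw [e]; exact annih_mem _
  | algebraMap r =>
    rw [← Algebra.commutes, mul_assoc, secondQuant_isom, mul_one]
    exact algebraMap_mem _ _
  | add x y _ _ hx hy => rw [mul_add, add_mul]; exact add_mem hx hy
  | mul x y _ _ hx hy =>
    have e : star (secondQuant W) * (x * y) * secondQuant W
      = (star (secondQuant W) * x * secondQuant W) * (star (secondQuant W) * y * secondQuant W) := by
      calc _ = star (secondQuant W) * x * 1 * y * secondQuant W := by simp [mul_assoc]
        _ = _ := by rw [← hunit]; simp only [mul_assoc]
    rw [e]; exact mul_mem hx hy
  | star x _ hx =>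
    have e : star (secondQuant W) * star x * secondQuant W
      = star (star (secondQuant W) * x * secondQuant W) := by simp [mul_assoc]
    rw [e]; exact star_mem hx

/-- Translation of a sequence: `j ↦ φ(j + k)`. -/
def shiftFun (k : ℤ) (φ : Hil ℤ) : Hil ℤ :=
  ⟨fun j => φ (j + k), by
    have h := (lp.memℓp φ).summable (by norm_num)
    exact memℓp_gen (h.comp_injective (add_left_injective k))⟩

/-- The bilateral shift `S` on `ℓ²(ℤ)`, `S Ψ_j = Ψ_{j-1}`, i.e. `(S φ)(j) = φ(j + 1)`. -/
def shift : Hil ℤ ≃ₗᵢ[ℂ] Hil ℤ where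
  toFun := shiftFun 1
  invFun := shiftFun (-1)
  map_add' φ ψ := rfl
  map_smul' c φ := rfl
  left_inv φ := by ext j; change φ (j + -1 + 1) = φ j; simp
  right_inv φ := by ext j; change φ (j + 1 + -1) = φ j; simp
  norm_map' φ := by
    rw [lp.norm_eq_tsum_rpow (by norm_num), lp.norm_eq_tsum_rpow (by norm_num)]
    congr 1
    exact (Equiv.addRight (1 : ℤ)).tsum_eq fun j => ‖φ j‖ ^ (2 : ENNReal).toReal

theorem shift_ket (j : ℤ) : shift (ket j) = ket (j - 1) := by
  ext k
  change (ket j : Hil ℤ) (k + 1) = ket (j - 1) k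
  simp only [ket, lp.single_apply, Pi.single_apply, eq_sub_iff_add_eq]

/-! ### Tensor products of Hilbert spaces -/

/-- The tensor product of two inner product spaces. In every use at least one factor is finite
dimensional, so that no completion is needed. -/
def HTensor (E F : Type) [NormedAddCommGroup E] [InnerProductSpace ℂ E] [NormedAddCommGroup F]
    [InnerProductSpace ℂ F] : Type := E ⊗[ℂ] F

section HTensor

variable {E F : Type} [NormedAddCommGroup E] [InnerProductSpace ℂ E] [NormedAddCommGroup F]
    [InnerProductSpace ℂ F]

instance instNormedHTensor : NormedAddCommGroup (HTensor E F) :=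
  inferInstanceAs (NormedAddCommGroup (E ⊗[ℂ] F))

instance instInnerHTensor : InnerProductSpace ℂ (HTensor E F) :=
  inferInstanceAs (InnerProductSpace ℂ (E ⊗[ℂ] F))

/-- The vector `x ⊗ y`, as a bounded bilinear map. -/
def tmulL : E →L[ℂ] F →L[ℂ] HTensor E F := TensorProduct.mkL ℂ E F

/-- The vector `x ⊗ y`. -/
def tmul (x : E) (y : F) : HTensor E F := tmulL x y

/-- The operator `A ⊗ B`. -/
def opTensor (A : E →L[ℂ] E) (B : F →L[ℂ] F) : HTensor E F →L[ℂ] HTensor E F :=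
  TensorProduct.mapL A B

theorem tmulL_apply (x : E) (y : F) : tmulL x y = tmul x y := rfl

theorem tmul_inner (x x' : E) (y y' : F) :
    inner ℂ (tmul x y) (tmul x' y') = inner ℂ x x' * inner ℂ y y' :=
  TensorProduct.inner_tmul ..

theorem opTensor_tmul (A : E →L[ℂ] E) (B : F →L[ℂ] F) (x : E) (y : F) :
    opTensor A B (tmul x y) = tmul (A x) (B y) := rfl

theorem htensor_induction {p : HTensor E F → Prop} (z : HTensor E F) (h0 : p 0)
    (ht : ∀ x y, p (tmul x y)) (ha : ∀ x y, p x → p y → p (x + y)) : p z :=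
  TensorProduct.induction_on (motive := p) z h0 ht ha

theorem opTensor_one : opTensor (1 : E →L[ℂ] E) (1 : F →L[ℂ] F) = 1 :=
  TensorProduct.mapL_id_id

theorem opTensor_mul (A A' : E →L[ℂ] E) (B B' : F →L[ℂ] F) :
    opTensor (A * A') (B * B') = opTensor A B * opTensor A' B' :=
  TensorProduct.mapL_mul A A' B B'

theorem opTensor_smul_left (c : ℂ) (A : E →L[ℂ] E) (B : F →L[ℂ] F) :
    opTensor (c • A) B = c • opTensor A B :=
  TensorProduct.mapL_smul_left c A B

theorem opTensor_smul_right (c : ℂ) (A : E →L[ℂ] E) (B : F →L[ℂ] F) :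
    opTensor A (c • B) = c • opTensor A B :=
  TensorProduct.mapL_smul_right c A B

theorem opTensor_add_left (A A' : E →L[ℂ] E) (B : F →L[ℂ] F) :
    opTensor (A + A') B = opTensor A B + opTensor A' B :=
  TensorProduct.mapL_add_left A A' B

theorem opTensor_add_right (A : E →L[ℂ] E) (B B' : F →L[ℂ] F) :
    opTensor A (B + B') = opTensor A B + opTensor A B' :=
  TensorProduct.mapL_add_right A B B'

end HTensor

theorem fin_expand {κ : Type} [Fintype κ] [DecidableEq κ] (f : Hil κ) :
    f = ∑ i, f i • ket i := by
  ext j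
  rw [lp.coeFn_sum, Finset.sum_apply]
  simp [ket, Pi.single_apply]

/-- The Fock space of the composite system, reservoir `⊗` sample. -/
abbrev Joint (d : ℕ) : Type := HTensor (Fock ℤ) (Fock (Fin d))

/-- `x ↦ x ⊗ e_S`. -/
def slot {d : ℕ} (S : Finset (Fin d)) : Fock ℤ →L[ℂ] Joint d := tmulL.flip (occ S)

theorem slot_apply {d : ℕ} (S : Finset (Fin d)) (x : Fock ℤ) : slot S x = tmul x (occ S) := rfl

theorem slot_inner {d : ℕ} (S T : Finset (Fin d)) (x y : Fock ℤ) :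
    inner ℂ (slot S x) (slot T y) = if S = T then inner ℂ x y else 0 := by
  rw [slot_apply, slot_apply, tmul_inner, occ_inner, occ_apply]
  split_ifs <;> simp

theorem slot_surj {d : ℕ} (z : Joint d) :
    ∃ x : Finset (Fin d) → Fock ℤ, z = ∑ S, slot S (x S) := by
  refine htensor_induction (p := fun z => ∃ x : Finset (Fin d) → Fock ℤ, z = ∑ S, slot S (x S)) z
    ⟨0, by simp⟩ (fun x y => ⟨fun S => y S • x, ?_⟩) ?_
  · conv_lhs => rw [fin_expand y, ← tmulL_apply, map_sum]
    exact Finset.sum_congr rfl fun S _ => by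
      rw [map_smul, map_smul, slot_apply, tmulL_apply]; rfl
  · rintro z w ⟨x, rfl⟩ ⟨y, rfl⟩
    exact ⟨x + y, by simp [Finset.sum_add_distrib]⟩

instance instCompleteJoint (d : ℕ) : CompleteSpace (Joint d) := by
  let Φ : PiLp 2 (fun _ : Finset (Fin d) => Fock ℤ) →ₗ[ℂ] Joint d :=
    { toFun := fun x => ∑ S, slot S (x S)
      map_add' := fun x y => by simp [Finset.sum_add_distrib]
      map_smul' := fun c x => by simp [Finset.smul_sum] }
  have hΦ : ∀ x y, inner ℂ (Φ x) (Φ y) = inner ℂ x y := by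
    intro x y
    change inner ℂ (∑ S, slot S (x S)) (∑ S, slot S (y S)) = _
    rw [sum_inner, PiLp.inner_apply]
    refine Finset.sum_congr rfl fun S _ => ?_
    rw [inner_sum]
    simp [slot_inner]
  let Ψ := Φ.isometryOfInner hΦ
  have hs : Function.Surjective Ψ := by
    intro z
    obtain ⟨x, rfl⟩ := slot_surj z
    exact ⟨WithLp.toLp 2 x, rfl⟩
  exact (LinearIsometryEquiv.ofSurjective Ψ hs).toIsometryEquiv.completeSpace_iff.1 inferInstance


/-- The block `(1 ⊗ ⟨e_S|) X (1 ⊗ |e_T⟩)` of an operator on the composite Fock space, an operator on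
the reservoir Fock space. -/
def block {d : ℕ} (S T : Finset (Fin d)) (X : Joint d →L[ℂ] Joint d) : Fock ℤ →L[ℂ] Fock ℤ :=
  (ContinuousLinearMap.adjoint (slot S)).comp (X.comp (slot T))

theorem slot_resolution {d : ℕ} :
    ∑ S : Finset (Fin d), (slot S).comp (ContinuousLinearMap.adjoint (slot S))
      = ContinuousLinearMap.id ℂ (Joint d) := by
  have h : ∀ (S T : Finset (Fin d)) (x : Fock ℤ),
      ContinuousLinearMap.adjoint (slot S) (slot T x) = if S = T then x else 0 := by
    intro S T x
    refine ext_inner_left ℂ fun y => ?_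
    rw [ContinuousLinearMap.adjoint_inner_right, slot_inner]
    split_ifs <;> simp
  ext z
  obtain ⟨x, rfl⟩ := slot_surj z
  rw [_root_.sum_apply]
  refine Finset.sum_congr rfl fun S _ => ?_
  simp [h, apply_ite]

theorem block_mul {d : ℕ} (S T : Finset (Fin d)) (X Y : Joint d →L[ℂ] Joint d) :
    block S T (X * Y) = ∑ R, block S R X * block R T Y := by
  have e : X * Y = X.comp ((∑ R : Finset (Fin d),
      (slot R).comp (ContinuousLinearMap.adjoint (slot R))).comp Y) := by
    rw [slot_resolution]; rfl
  rw [e]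
  ext f : 1
  simp [block, map_sum]

theorem block_star {d : ℕ} (S T : Finset (Fin d)) (X : Joint d →L[ℂ] Joint d) :
    block S T (star X) = star (block T S X) := by
  simp only [block, ContinuousLinearMap.star_eq_adjoint, ContinuousLinearMap.adjoint_comp,
    ContinuousLinearMap.adjoint_adjoint]
  rfl

theorem block_opTensor {d : ℕ} (S T : Finset (Fin d)) (A : Fock ℤ →L[ℂ] Fock ℤ)
    (B : Fock (Fin d) →L[ℂ] Fock (Fin d)) :
    block S T (opTensor A B) = (inner ℂ (occ S) (B (occ T)) : ℂ) • A := by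
  ext f : 1
  refine ext_inner_left ℂ fun y => ?_
  simp only [block, ContinuousLinearMap.comp_apply, ContinuousLinearMap.adjoint_inner_right,
    slot_apply, opTensor_tmul, tmul_inner, _root_.smul_apply,
    inner_smul_right]
  ring

theorem block_continuous {d : ℕ} (S T : Finset (Fin d)) : Continuous (block (d := d) S T) := by
  unfold block; fun_prop

/-- The C⋆-tensor product of the reservoir algebra with the sample algebra of all operators on the
finite dimensional sample Fock space: operators all of whose blocks lie in the reservoir algebra. -/
def jointAlg (d : ℕ) : StarSubalgebra ℂ (Joint d →L[ℂ] Joint d) where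
  carrier := {X | ∀ S T, block S T X ∈ carAlg ℤ}
  mul_mem' := fun {X Y} hX hY S T => by
    rw [block_mul]; exact sum_mem fun R _ => mul_mem (hX S R) (hY R T)
  add_mem' := fun {X Y} hX hY S T => by
    have : block S T (X + Y) = block S T X + block S T Y := by ext f : 1; simp [block]
    rw [this]; exact add_mem (hX S T) (hY S T)
  algebraMap_mem' := fun c S T => by
    have : algebraMap ℂ (Joint d →L[ℂ] Joint d) c
        = opTensor (c • (1 : Fock ℤ →L[ℂ] Fock ℤ)) 1 := by
      rw [opTensor_smul_left, Algebra.algebraMap_eq_smul_one]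
      congr 1
      exact opTensor_one.symm
    rw [this, block_opTensor]
    exact (carAlg ℤ).smul_mem ((carAlg ℤ).smul_mem (one_mem _) _) _
  star_mem' := fun {X} hX S T => by
    rw [block_star]; exact star_mem (hX T S)

theorem mem_jointAlg {d : ℕ} {X : Joint d →L[ℂ] Joint d} :
    X ∈ jointAlg d ↔ ∀ S T, block S T X ∈ carAlg ℤ := Iff.rfl

/-- The block `(1 ⊗ ⟨e_S|) X (1 ⊗ |e_T⟩)` as an element of the reservoir algebra. -/
def blockRes {d : ℕ} (X : jointAlg d) (S T : Finset (Fin d)) : carAlg ℤ :=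
  ⟨block S T (X : Joint d →L[ℂ] Joint d), mem_jointAlg.1 X.2 S T⟩

theorem jointAlg_isClosed (d : ℕ) : IsClosed (jointAlg d : Set (Joint d →L[ℂ] Joint d)) := by
  have : (jointAlg d : Set (Joint d →L[ℂ] Joint d))
      = ⋂ S, ⋂ T, {X | block S T X ∈ carAlg ℤ} := by
    ext X
    simp only [Set.mem_iInter]
    rfl
  rw [this]
  exact isClosed_iInter fun S => isClosed_iInter fun T =>
    (carAlg_isClosed ℤ).preimage (block_continuous S T)

theorem opTensor_mem {d : ℕ} {A : Fock ℤ →L[ℂ] Fock ℤ} (hA : A ∈ carAlg ℤ)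
    (B : Fock (Fin d) →L[ℂ] Fock (Fin d)) : opTensor A B ∈ jointAlg d := fun S T => by
  rw [block_opTensor]; exact (carAlg ℤ).smul_mem hA _

/-- The coupling `b₀* ⊗ a₀ + b₀ ⊗ a₀*` (reservoir factor first). -/
def coupling (d : ℕ) [NeZero d] : Joint d →L[ℂ] Joint d :=
  opTensor (create (ket 0)) (annih (ket 0))
    + opTensor (annih (ket 0)) (create (ket 0))

/-- `K = exp[-iα(b₀* ⊗ a₀ + b₀ ⊗ a₀*)]`. -/
def couplingUnitary (d : ℕ) [NeZero d] (α : ℝ) : Joint d →L[ℂ] Joint d :=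
  NormedSpace.exp ((-Complex.I * α) • coupling d)

/-- The free dynamics `Γ(S) ⊗ Γ(W)`. -/
def freeStep {d : ℕ} (W : Hil (Fin d) ≃ₗᵢ[ℂ] Hil (Fin d)) : Joint d →L[ℂ] Joint d :=
  opTensor (secondQuant shift) (secondQuant W)

/-- The one time stepUnitary dynamics `U = (Γ(S) ⊗ Γ(W)) K`. -/
def stepUnitary {d : ℕ} [NeZero d] (W : Hil (Fin d) ≃ₗᵢ[ℂ] Hil (Fin d)) (α : ℝ) :
    Joint d →L[ℂ] Joint d :=
  freeStep W * couplingUnitary d α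

theorem couplingUnitary_mem (d : ℕ) [NeZero d] (α : ℝ) : couplingUnitary d α ∈ jointAlg d := by
  have hc : coupling d ∈ jointAlg d := by
    refine add_mem (opTensor_mem ?_ _) (opTensor_mem (annih_mem _) _)
    have := star_mem (annih_mem (ι := ℤ) (ket 0))
    rwa [annih, star_star] at this
  rw [couplingUnitary, NormedSpace.exp_eq_tsum ℂ]
  exact tsum_mem (jointAlg_isClosed d) fun n =>
    (jointAlg d).smul_mem (pow_mem ((jointAlg d).smul_mem hc _) n) _

theorem freeStep_mem {d : ℕ} (W : Hil (Fin d) ≃ₗᵢ[ℂ] Hil (Fin d)) {X : Joint d →L[ℂ] Joint d}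
    (hX : X ∈ jointAlg d) : star (freeStep W) * X * freeStep W ∈ jointAlg d := by
  set G := secondQuant shift
  have e : freeStep W = opTensor G 1 * opTensor 1 (secondQuant W) := by
    rw [← opTensor_mul, mul_one, one_mul]; rfl
  have h1 : star (opTensor G (1 : Fock (Fin d) →L[ℂ] Fock (Fin d))) * X
      * opTensor G 1 ∈ jointAlg d := by
    intro S T
    have hs : ∀ T : Finset (Fin d), (opTensor G 1).comp (slot T) = (slot T).comp G := by
      intro T; rfl
    have : block S T (star (opTensor G (1 : Fock (Fin d) →L[ℂ] Fock (Fin d))) * X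
      * opTensor G 1) = star G * block S T X * G := by
      have hs' := congrArg ContinuousLinearMap.adjoint (hs S)
      rw [ContinuousLinearMap.adjoint_comp, ContinuousLinearMap.adjoint_comp] at hs'
      calc _ = ((ContinuousLinearMap.adjoint (slot S)).comp
              (ContinuousLinearMap.adjoint (opTensor G 1))).comp
              (X.comp ((opTensor G 1).comp (slot T))) := rfl
        _ = _ := by rw [hs', hs]; rfl
    rw [this]
    exact carAlg_conj shift (hX S T)
  have h2 : opTensor (1 : Fock ℤ →L[ℂ] Fock ℤ) (secondQuant W) ∈ jointAlg d :=
    opTensor_mem (one_mem _) _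
  have h3 := mul_mem (mul_mem (star_mem h2) h1) h2
  rw [e, star_mul]
  simpa only [mul_assoc] using h3

theorem stepUnitary_pow_mem {d : ℕ} [NeZero d] (W : Hil (Fin d) ≃ₗᵢ[ℂ] Hil (Fin d)) (α : ℝ) (t : ℕ)
    {X : Joint d →L[ℂ] Joint d} (hX : X ∈ jointAlg d) :
    star (stepUnitary W α) ^ t * X * stepUnitary W α ^ t ∈ jointAlg d := by
  induction t with
  | zero => simpa using hX
  | succ t ih =>
    have hK := couplingUnitary_mem d α
    have h := mul_mem (mul_mem (star_mem hK) (freeStep_mem W ih)) hK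
    rw [pow_succ', pow_succ]
    have e : star (stepUnitary W α) = star (couplingUnitary d α) * star (freeStep W) := star_mul _ _
    nth_rewrite 1 [e]
    nth_rewrite 3 [stepUnitary]
    simpa only [mul_assoc] using h

/-- The Heisenberg evolution `τᵗ(X) = U*ᵗ X Uᵗ`. -/
def evolve {d : ℕ} [NeZero d] (W : Hil (Fin d) ≃ₗᵢ[ℂ] Hil (Fin d)) (α : ℝ) (t : ℕ)
    (X : jointAlg d) : jointAlg d :=
  ⟨star (stepUnitary W α) ^ t * X * stepUnitary W α ^ t, stepUnitary_pow_mem W α t X.2⟩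

/-- The observable `1 ⊗ A`, for an observable `A` of the sample. -/
def sampleObs {d : ℕ} (A : Fock (Fin d) →L[ℂ] Fock (Fin d)) : jointAlg d :=
  ⟨opTensor 1 A, opTensor_mem (one_mem _) A⟩

/-- A state of the reservoir: a positive normalized linear functional on the reservoir C⋆-algebra. -/
structure IsState (ω : carAlg ℤ →ₗ[ℂ] ℂ) : Prop where
  map_one : ω 1 = 1
  nonneg : ∀ A : carAlg ℤ, 0 ≤ ω (star A * A)

/-- `b(ψ)` as an element of the reservoir algebra. -/
def resAnnih (ψ : Hil ℤ) : carAlg ℤ := ⟨annih ψ, annih_mem ψ⟩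

/-- `b*(φ)` as an element of the reservoir algebra. -/
def resCreate (φ : Hil ℤ) : carAlg ℤ := star (resAnnih φ)

/-- `ω` is the gauge-invariant quasi-free state with density `Sig`:
`ω(b*(φ_m) ⋯ b*(φ_1) b(ψ_1) ⋯ b(ψ_n)) = δ_{nm} det {⟨ψ_j, Sig φ_k⟩}`. Since such products span a dense
subspace of the algebra, this determines `ω`. -/
structure IsQuasiFree (ω : carAlg ℤ →ₗ[ℂ] ℂ) (Sig : Hil ℤ →L[ℂ] Hil ℤ) : Prop
    extends IsState ω where
  moments : ∀ (n : ℕ) (φ ψ : Fin n → Hil ℤ),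
    ω ((List.ofFn fun i => resCreate (φ i)).reverse.prod * (List.ofFn fun i => resAnnih (ψ i)).prod)
      = Matrix.det (Matrix.of fun j k => (inner ℂ (ψ j) (Sig (φ k)) : ℂ))
  gauge : ∀ (m n : ℕ) (φ : Fin m → Hil ℤ) (ψ : Fin n → Hil ℤ), m ≠ n →
    ω ((List.ofFn fun i => resCreate (φ i)).reverse.prod * (List.ofFn fun i => resAnnih (ψ i)).prod)
      = 0

/-- A density matrix on the sample Fock space: a positive operator of trace one. -/
structure IsDensityMatrix {d : ℕ} (ρ : Fock (Fin d) →L[ℂ] Fock (Fin d)) : Prop where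
  pos : ρ.IsPositive
  trace_one : LinearMap.trace ℂ _ ρ.toLinearMap = 1

/-- The product functional `ω ⊗ ρ`, with `ρ(A) = tr(ρ A)`: on `B ⊗ A` it takes the value
`ω(B) tr(ρ A)`. -/
def prodState {d : ℕ} (ω : carAlg ℤ →ₗ[ℂ] ℂ) (ρ : Fock (Fin d) →L[ℂ] Fock (Fin d))
    (X : jointAlg d) : ℂ :=
  ∑ S, ∑ T, (inner ℂ (occ T) (ρ (occ S)) : ℂ) * ω (blockRes X S T)

/-- `H ⊗ H` for the one particle space `H` of the sample. -/
abbrev Pair (d : ℕ) : Type := HTensor (Hil (Fin d)) (Hil (Fin d))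

/-- The exchange operator `u ⊗ v ↦ v ⊗ u`. -/
def exchange (d : ℕ) : Pair d →L[ℂ] Pair d :=
  ((TensorProduct.commIsometry ℂ (Hil (Fin d)) (Hil (Fin d))).toContinuousLinearEquiv :
    Hil (Fin d) ⊗[ℂ] Hil (Fin d) →L[ℂ] Hil (Fin d) ⊗[ℂ] Hil (Fin d))

theorem exchange_tmul {d : ℕ} (u v : Hil (Fin d)) : exchange d (tmul u v) = tmul v u := rfl

/-- The projection `P_A = (1 - Θ) / 2`, `Θ` the exchange operator, onto antisymmetric tensors. -/
def antisymProj (d : ℕ) : Pair d →L[ℂ] Pair d := (1 / 2 : ℂ) • (1 - exchange d)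

/-- The space `H ∧ H`. -/
abbrev Wedge2 (d : ℕ) : Submodule ℂ (Pair d) := LinearMap.range (antisymProj d).toLinearMap

/-- `P_A X P_A` as an operator on `H ∧ H`. -/
def compress {d : ℕ} (X : Pair d →L[ℂ] Pair d) : Wedge2 d →L[ℂ] Wedge2 d :=
  ((antisymProj d * X * antisymProj d).comp (Wedge2 d).subtypeL).codRestrict (Wedge2 d)
    (fun _ => ⟨_, rfl⟩)

/-- `u ∧ v = (u ⊗ v - v ⊗ u) / √2`. -/
def wedge2 {d : ℕ} (u v : Hil (Fin d)) : Wedge2 d :=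
  ⟨((1 / Real.sqrt 2 : ℝ) : ℂ) • (tmul u v - tmul v u), by
    refine ⟨((1 / Real.sqrt 2 : ℝ) : ℂ) • (tmul u v - tmul v u), ?_⟩
    simp only [antisymProj, ContinuousLinearMap.coe_coe, map_smul]
    congr 1
    simp only [_root_.smul_apply, _root_.sub_apply, one_apply_eq_self, map_sub, exchange_tmul]
    module⟩

/-- `(ω ⊗ ρ)(τᵗ(1 ⊗ a*_{k₁} a*_{k₂} a_{j₂} a_{j₁}))`. -/
def rdmEntry {d : ℕ} [NeZero d] (W : Hil (Fin d) ≃ₗᵢ[ℂ] Hil (Fin d)) (α : ℝ)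
    (ω : carAlg ℤ →ₗ[ℂ] ℂ) (ρ : Fock (Fin d) →L[ℂ] Fock (Fin d)) (t : ℕ)
    (j₁ j₂ k₁ k₂ : Fin d) : ℂ :=
  prodState ω ρ (evolve W α t (sampleObs
    (create (ket k₁) * create (ket k₂) * annih (ket j₂) * annih (ket j₁))))

/-- The two-body reduced density matrix at time `t`: the operator on `H ∧ H` whose matrix elements
`⟨e_{j₁} ∧ e_{j₂}, · e_{k₁} ∧ e_{k₂}⟩` are the numbers `rdmEntry`. It is written in the orthonormal
basis `e_j ∧ e_k`, `j < k`; `rdm2_inner` gives all matrix elements. -/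
def rdm2 {d : ℕ} [NeZero d] (W : Hil (Fin d) ≃ₗᵢ[ℂ] Hil (Fin d)) (α : ℝ)
    (ω : carAlg ℤ →ₗ[ℂ] ℂ) (ρ : Fock (Fin d) →L[ℂ] Fock (Fin d)) (t : ℕ) :
    Wedge2 d →L[ℂ] Wedge2 d :=
  ∑ j₁, ∑ j₂ ∈ Finset.Ioi j₁, ∑ k₁, ∑ k₂ ∈ Finset.Ioi k₁,
    rdmEntry W α ω ρ t j₁ j₂ k₁ k₂ •
      InnerProductSpace.rankOne ℂ (wedge2 (ket j₁) (ket j₂)) (wedge2 (ket k₁) (ket k₂))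

/-- The matrix `M = W (1 + (cos α - 1) |e₀⟩⟨e₀|)`. -/
def oneStepMatrix {d : ℕ} [NeZero d] (W : Hil (Fin d) ≃ₗᵢ[ℂ] Hil (Fin d)) (α : ℝ) :
    Hil (Fin d) →L[ℂ] Hil (Fin d) :=
  (W : Hil (Fin d) →L[ℂ] Hil (Fin d)).comp
    (1 + ((Real.cos α - 1 : ℝ) : ℂ) • InnerProductSpace.rankOne ℂ (ket 0) (ket 0))


theorem wedge2_inner {d : ℕ} (a b j k : Fin d) :
    inner ℂ (wedge2 (ket a) (ket b)) (wedge2 (ket j) (ket k))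
      = (if a = j then (1 : ℂ) else 0) * (if b = k then 1 else 0)
        - (if a = k then 1 else 0) * (if b = j then 1 else 0) := by
  have h2 : ((1 / Real.sqrt 2 : ℝ) : ℂ) * ((1 / Real.sqrt 2 : ℝ) : ℂ) = 1 / 2 := by
    rw [← Complex.ofReal_mul, div_mul_div_comm, Real.mul_self_sqrt (by norm_num)]; norm_num
  rw [Submodule.coe_inner]
  simp only [wedge2, inner_smul_left, inner_smul_right, inner_sub_left, inner_sub_right, tmul_inner,
    ket_inner_ket, Complex.conj_ofReal]
  generalize ((1 / Real.sqrt 2 : ℝ) : ℂ) = c at h2 ⊢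
  linear_combination (2 * ((if a = j then (1 : ℂ) else 0) * (if b = k then 1 else 0)
        - (if a = k then 1 else 0) * (if b = j then 1 else 0))) * h2

theorem sum_antisymm {d : ℕ} (h : Fin d → Fin d → ℂ) (hh : ∀ j k, h j k = -h k j) (a b : Fin d) :
    ∑ j, ∑ k ∈ Finset.Ioi j, h j k * ((if a = j then (1 : ℂ) else 0) * (if b = k then 1 else 0)
        - (if a = k then 1 else 0) * (if b = j then 1 else 0)) = h a b := by
  have e : ∀ j, ∑ k ∈ Finset.Ioi j, h j k * ((if a = j then (1 : ℂ) else 0) *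
      (if b = k then 1 else 0) - (if a = k then 1 else 0) * (if b = j then 1 else 0))
      = (if a = j then (if a < b then h a b else 0) else 0)
        - (if b = j then (if b < a then h b a else 0) else 0) := by
    intro j
    simp only [mul_sub, Finset.sum_sub_distrib]
    congr 1
    · by_cases haj : a = j
      · subst haj
        simp only [if_true, mul_ite, mul_one, mul_zero, Finset.sum_ite_eq, Finset.mem_Ioi]
      · simp [haj]
    · by_cases hbj : b = j
      · subst hbj
        simp only [if_true, mul_ite, mul_one, mul_zero, Finset.sum_ite_eq, Finset.mem_Ioi]
      · simp [hbj]
  simp only [e, Finset.sum_sub_distrib, Finset.sum_ite_eq, Finset.mem_univ, if_true]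
  rcases lt_trichotomy a b with hab | hab | hab
  · simp [hab, hab.not_gt]
  · subst hab
    have := hh a a
    simp only [lt_irrefl, if_false, sub_zero]
    linear_combination -(1 / 2 : ℂ) * this
  · simp [hab, hab.not_gt, hh a b]

theorem prodState_neg {d : ℕ} (ω : carAlg ℤ →ₗ[ℂ] ℂ) (ρ : Fock (Fin d) →L[ℂ] Fock (Fin d))
    (X : jointAlg d) : prodState ω ρ (-X) = -prodState ω ρ X := by
  have h : ∀ S T, blockRes (-X) S T = -blockRes X S T := by
    intro S T
    apply Subtype.ext
    change block S T (-(X : Joint d →L[ℂ] Joint d)) = -block S T (X : Joint d →L[ℂ] Joint d)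
    ext f : 1
    simp [block]
  simp only [prodState, h, map_neg, mul_neg, Finset.sum_neg_distrib]

theorem prodState_sample_neg {d : ℕ} [NeZero d] (W : Hil (Fin d) ≃ₗᵢ[ℂ] Hil (Fin d)) (α : ℝ)
    (ω : carAlg ℤ →ₗ[ℂ] ℂ) (ρ : Fock (Fin d) →L[ℂ] Fock (Fin d)) (t : ℕ)
    (A : Fock (Fin d) →L[ℂ] Fock (Fin d)) :
    prodState ω ρ (evolve W α t (sampleObs (-A))) = -prodState ω ρ (evolve W α t (sampleObs A)) := by
  have h1 : sampleObs (-A) = -sampleObs A := by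
    apply Subtype.ext
    change opTensor (1 : Fock ℤ →L[ℂ] Fock ℤ) (-A) = -opTensor 1 A
    rw [← neg_one_smul ℂ A, opTensor_smul_right, neg_one_smul]
  have h2 : ∀ X : jointAlg d, evolve W α t (-X) = -evolve W α t X := by
    intro X
    apply Subtype.ext
    change star (stepUnitary W α) ^ t * -(X : Joint d →L[ℂ] Joint d) * stepUnitary W α ^ t
      = -(star (stepUnitary W α) ^ t * (X : Joint d →L[ℂ] Joint d) * stepUnitary W α ^ t)
    rw [mul_neg, neg_mul]
  rw [h1, h2, prodState_neg]

/-- The operator `rdm2` has the matrix elements prescribed by `rdmEntry`. -/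
theorem rdm2_inner {d : ℕ} [NeZero d] (W : Hil (Fin d) ≃ₗᵢ[ℂ] Hil (Fin d)) (α : ℝ)
    (ω : carAlg ℤ →ₗ[ℂ] ℂ) (ρ : Fock (Fin d) →L[ℂ] Fock (Fin d)) (t : ℕ) (j₁ j₂ k₁ k₂ : Fin d) :
    inner ℂ (wedge2 (ket j₁) (ket j₂)) (rdm2 W α ω ρ t (wedge2 (ket k₁) (ket k₂)))
      = rdmEntry W α ω ρ t j₁ j₂ k₁ k₂ := by
  have hk : ∀ j₁ j₂ k₁ k₂, rdmEntry W α ω ρ t j₁ j₂ k₁ k₂ = -rdmEntry W α ω ρ t j₁ j₂ k₂ k₁ := by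
    intro j₁ j₂ k₁ k₂
    rw [rdmEntry, eq_neg_of_add_eq_zero_left (create_anti (ket k₁ : Hil (Fin d)) (ket k₂)), neg_mul,
      neg_mul, prodState_sample_neg]; rfl
  have hj : ∀ j₁ j₂ k₁ k₂, rdmEntry W α ω ρ t j₁ j₂ k₁ k₂ = -rdmEntry W α ω ρ t j₂ j₁ k₁ k₂ := by
    intro j₁ j₂ k₁ k₂
    have h := congrArg star (create_anti (ket j₁ : Hil (Fin d)) (ket j₂))
    rw [star_add, star_mul, star_mul, star_zero] at h
    have h' : annih (ket j₂ : Hil (Fin d)) * annih (ket j₁) = -(annih (ket j₁) * annih (ket j₂)) :=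
      eq_neg_of_add_eq_zero_left h
    rw [rdmEntry, mul_assoc, h', mul_neg, prodState_sample_neg, ← mul_assoc]; rfl
  simp only [rdm2, _root_.sum_apply, _root_.smul_apply, InnerProductSpace.rankOne_apply, inner_sum,
    inner_smul_right, wedge2_inner]
  have h1 : ∀ a b, ∑ c, ∑ e ∈ Finset.Ioi c, rdmEntry W α ω ρ t a b c e *
      ((if k₁ = c then (1 : ℂ) else 0) * (if k₂ = e then 1 else 0)
        - (if k₁ = e then 1 else 0) * (if k₂ = c then 1 else 0)) = rdmEntry W α ω ρ t a b k₁ k₂ :=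
    fun a b => sum_antisymm _ (hk a b) k₁ k₂
  have h2 := sum_antisymm (fun a b => rdmEntry W α ω ρ t a b k₁ k₂) (fun a b => hj a b k₁ k₂) j₁ j₂
  rw [← h2]
  refine Finset.sum_congr rfl fun a _ => Finset.sum_congr rfl fun b _ => ?_
  rw [← h1 a b, Finset.sum_mul]
  refine Finset.sum_congr rfl fun c _ => ?_
  rw [Finset.sum_mul]
  refine Finset.sum_congr rfl fun e _ => ?_
  have dl : ∀ x y : Fin d, (if x = y then (1 : ℂ) else 0) = if y = x then 1 else 0 := fun x y => by
    by_cases h : x = y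
    · rw [if_pos h, if_pos h.symm]
    · rw [if_neg h, if_neg (Ne.symm h)]
  rw [dl c k₁, dl e k₂, dl c k₂, dl e k₁]
  ring

end FermiWalk

end

open FermiWalk

/-!
The coupling `b₀* ⊗ a₀ + b₀ ⊗ a₀*` is not quadratic in one family of fermionic modes, because the
operators of the reservoir commute with those of the sample instead of anticommuting. With the parity
`Q = (-1)^N` of the sample, the operators `A(φ) = 1 ⊗ i a(φ) Q` and `B(f) = b(f) ⊗ Q` do satisfy joint
canonical anticommutation relations, and the coupling equals `i (B₀* A₀ - A₀* B₀)`. Hence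
`A(e₀) ± i B(Ψ₀)` are eigenvectors of the commutator with the coupling (`coupling_sampleMode`,
`coupling_resMode`), conjugation by `K` rotates `A(e₀)` and `B(Ψ₀)` into each other by the angle `α`,
and all orthogonal modes are left alone. The factors `i` and `Q` cancel in the two-body observables
(`sample_two_body`), so nothing is lost by working with `A`.

One step of the dynamics maps `A(φ)` to `A(M* φ)` plus a reservoir mode at the site `0`, which the shift
then carries to the right, away from the contact. So after `t` steps `A(φ)` has become
`A(M*ᵗ φ) + B(f_t)` for some reservoir vector `f_t` (`evolve_sampleMode`). The anticommutation
relations are preserved by the unitary evolution, which forces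
`⟨f_t(φ), f_t(ψ)⟩ = ⟨φ, ψ⟩ - ⟨M*ᵗ φ, M*ᵗ ψ⟩` (`emitted_inner`). In particular `M` is a contraction; as it
has no spectrum on the unit circle, its spectral radius is less than one and `M*ᵗ → 0`
(`tendsto_star_oneStepMatrix_pow`).

Therefore the evolved two-body observable is asymptotic, in norm, to the reservoir observable
`b*(f_{k₁}) b*(f_{k₂}) b(f_{j₂}) b(f_{j₁}) ⊗ 1` (`tendsto_evolve_two_body`). The state `ω ⊗ ρ` is norm
continuous, and on this observable it gives the determinant of the matrix `σ ⟨f_j, f_k⟩`, whatever `ρ`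
is. By the formula for the inner products this converges to `σ² ⟨e_{j₁} ∧ e_{j₂}, e_{k₁} ∧ e_{k₂}⟩`, the
matrix element of `σ² 1`.
-/

namespace FermiWalk

/-! ### Adjoints and parity -/

theorem star_opTensor {d : ℕ} (A : Fock ℤ →L[ℂ] Fock ℤ) (B : Fock (Fin d) →L[ℂ] Fock (Fin d)) :
    star (opTensor A B) = opTensor (star A) (star B) := by
  rw [ContinuousLinearMap.star_eq_adjoint]
  symm
  rw [ContinuousLinearMap.eq_adjoint_iff]
  intro z w
  refine htensor_induction
    (p := fun z => inner ℂ (opTensor (star A) (star B) z) w = inner ℂ z (opTensor A B w)) z ?_ ?_ ?_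
  · simp
  · intro x y
    refine htensor_induction (p := fun w => inner ℂ (opTensor (star A) (star B) (tmul x y)) w
      = inner ℂ (tmul x y) (opTensor A B w)) w ?_ ?_ ?_
    · simp
    · intro x' y'
      rw [opTensor_tmul, opTensor_tmul, tmul_inner, tmul_inner, ContinuousLinearMap.star_eq_adjoint,
        ContinuousLinearMap.star_eq_adjoint, ContinuousLinearMap.adjoint_inner_left,
        ContinuousLinearMap.adjoint_inner_left]
    · intro w w' h h'
      rw [inner_add_right, h, h', map_add, inner_add_right]
  · intro z z' h h'
    rw [map_add, inner_add_left, h, h', inner_add_left]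

theorem annih_add {ι : Type} [LinearOrder ι] (φ ψ : Hil ι) :
    annih (φ + ψ) = annih φ + annih ψ := by
  rw [annih, create_add, star_add]; rfl

theorem annih_smul {ι : Type} [LinearOrder ι] (c : ℂ) (φ : Hil ι) :
    annih (c • φ) = star c • annih φ := by
  rw [annih, create_smul, star_smul]; rfl

theorem annih_anti {ι : Type} [LinearOrder ι] (φ ψ : Hil ι) :
    annih φ * annih ψ = -(annih ψ * annih φ) := by
  have h := congrArg star (create_anti ψ φ)
  rw [star_add, star_mul, star_mul, star_zero] at h
  exact eq_neg_of_add_eq_zero_left h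

theorem secondQuant_conj_annih {ι : Type} [LinearOrder ι] (W : Hil ι ≃ₗᵢ[ℂ] Hil ι) (φ : Hil ι) :
    star (secondQuant W) * annih φ * secondQuant W = annih (W.symm φ) := by
  have h : star (secondQuant W) * create φ * secondQuant W = create (W.symm φ) := by
    rw [secondQuant_star, secondQuant_create, mul_assoc]
    have := secondQuant_symm W.symm
    rw [LinearIsometryEquiv.symm_symm] at this
    rw [this, mul_one]
  rw [annih, annih, ← h]; simp [mul_assoc]

/-- The fermion parity `(-1)^N`, as the second quantization of `-1`. -/
noncomputable def parity (ι : Type) [LinearOrder ι] : Fock ι →L[ℂ] Fock ι :=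
  secondQuant (LinearIsometryEquiv.neg ℂ)

theorem star_parity (ι : Type) [LinearOrder ι] : star (parity ι) = parity ι :=
  secondQuant_star _

theorem parity_sq (ι : Type) [LinearOrder ι] : parity ι * parity ι = 1 :=
  secondQuant_symm (LinearIsometryEquiv.neg ℂ)

theorem parity_create {ι : Type} [LinearOrder ι] (φ : Hil ι) :
    parity ι * create φ = -(create φ * parity ι) := by
  have h : create (-φ) = -create φ := by
    rw [← neg_one_smul ℂ φ, create_smul, neg_one_smul]
  rw [← neg_mul, ← h]
  exact secondQuant_create (LinearIsometryEquiv.neg ℂ) φ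

theorem parity_annih {ι : Type} [LinearOrder ι] (φ : Hil ι) :
    parity ι * annih φ = -(annih φ * parity ι) := by
  have h := congrArg star (parity_create φ)
  rw [star_neg, star_mul, star_mul, star_parity] at h
  rw [annih, h, neg_neg]

theorem secondQuant_conj_parity {ι : Type} [LinearOrder ι] (W : Hil ι ≃ₗᵢ[ℂ] Hil ι) :
    star (secondQuant W) * parity ι * secondQuant W = parity ι := by
  have h : parity ι * secondQuant W = secondQuant W * parity ι := by
    refine fock_ext fun S => ?_
    change secondQuant _ (secondQuant W (occ S)) = secondQuant W (secondQuant _ (occ S))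
    rw [secondQuant_occ, secondQuant_occ, secondQuant_wedge, secondQuant_wedge]
    simp
  rw [mul_assoc, h, ← mul_assoc, secondQuant_isom, one_mul]

/-! ### The Jordan–Wigner modes of the composite system -/

section Modes

variable {d : ℕ}

/-- The sample mode `A(φ) = 1 ⊗ i a(φ) (-1)^N`. The factor `i (-1)^N` is what makes the coupling
quadratic in the modes `A`, `B`; it is invisible in even observables, see `sample_two_body`. -/
noncomputable def sampleMode (φ : Hil (Fin d)) : Joint d →L[ℂ] Joint d :=
  opTensor 1 (Complex.I • (annih φ * parity (Fin d)))

/-- The reservoir mode `B(f) = b(f) ⊗ (-1)^N`, which anticommutes with the sample modes. -/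
noncomputable def resMode (d : ℕ) (f : Hil ℤ) : Joint d →L[ℂ] Joint d :=
  opTensor (annih f) (parity (Fin d))

theorem sampleMode_add (φ ψ : Hil (Fin d)) :
    sampleMode (φ + ψ) = sampleMode φ + sampleMode ψ := by
  rw [sampleMode, annih_add, add_mul, smul_add, opTensor_add_right]; rfl

theorem sampleMode_smul (c : ℂ) (φ : Hil (Fin d)) :
    sampleMode (c • φ) = star c • sampleMode φ := by
  rw [sampleMode, annih_smul, smul_mul_assoc, smul_comm, opTensor_smul_right]; rfl

theorem resMode_add (f g : Hil ℤ) : resMode d (f + g) = resMode d f + resMode d g := by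
  rw [resMode, annih_add, opTensor_add_left]; rfl

theorem resMode_smul (c : ℂ) (f : Hil ℤ) : resMode d (c • f) = star c • resMode d f := by
  rw [resMode, annih_smul, opTensor_smul_left]; rfl

theorem star_sampleMode (φ : Hil (Fin d)) :
    star (sampleMode φ) = opTensor 1 (Complex.I • (create φ * parity (Fin d))) := by
  rw [sampleMode, star_opTensor, star_one, star_smul, star_mul, star_parity, annih, star_star,
    parity_create]
  congr 1
  simp

theorem star_resMode (f : Hil ℤ) :
    star (resMode d f) = opTensor (create f) (parity (Fin d)) := by
  rw [resMode, star_opTensor, star_parity, annih, star_star]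

/-- The scalars `i` and the parities cancel in pairs. -/
theorem parity_sandwich (X Y : Fock (Fin d) →L[ℂ] Fock (Fin d))
    (h : parity (Fin d) * Y = -(Y * parity (Fin d))) :
    (Complex.I • (X * parity (Fin d))) * (Complex.I • (Y * parity (Fin d))) = X * Y := by
  have e : X * parity (Fin d) * (Y * parity (Fin d)) = -(X * Y) := by
    rw [mul_assoc, ← mul_assoc (parity _) Y, h, neg_mul, mul_assoc Y, parity_sq, mul_one, mul_neg]
  rw [smul_mul_smul_comm, e, Complex.I_mul_I, neg_smul, one_smul, neg_neg]

theorem sampleMode_car (φ ψ : Hil (Fin d)) :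
    sampleMode φ * star (sampleMode ψ) + star (sampleMode ψ) * sampleMode φ
      = (inner ℂ φ ψ : ℂ) • 1 := by
  rw [star_sampleMode, sampleMode, ← opTensor_mul, ← opTensor_mul,
    parity_sandwich _ _ (parity_create ψ), parity_sandwich _ _ (parity_annih φ),
    ← opTensor_add_right, car, mul_one, opTensor_smul_right, opTensor_one]

theorem resMode_car (f g : Hil ℤ) :
    resMode d f * star (resMode d g) + star (resMode d g) * resMode d f
      = (inner ℂ f g : ℂ) • 1 := by
  rw [star_resMode, resMode, ← opTensor_mul, ← opTensor_mul, ← opTensor_add_left, car, parity_sq,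
    opTensor_smul_left, opTensor_one]

theorem sampleMode_resMode_car (φ : Hil (Fin d)) (g : Hil ℤ) :
    sampleMode φ * star (resMode d g) + star (resMode d g) * sampleMode φ = 0 := by
  rw [star_resMode, sampleMode, ← opTensor_mul, ← opTensor_mul, one_mul, mul_one,
    ← opTensor_add_right, smul_mul_assoc, mul_smul_comm, ← mul_assoc, parity_annih, neg_mul,
    ← smul_add, add_neg_cancel, smul_zero]
  simpa using opTensor_smul_right (0 : ℂ) (create g) (1 : Fock (Fin d) →L[ℂ] Fock (Fin d))

theorem resMode_sampleMode_car (f : Hil ℤ) (ψ : Hil (Fin d)) :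
    resMode d f * star (sampleMode ψ) + star (sampleMode ψ) * resMode d f = 0 := by
  have h := congrArg star (sampleMode_resMode_car ψ f)
  simpa only [star_add, star_mul, star_star, star_zero] using h

/-- The two-body observables of the sample are the same monomials in the modes `A(φ)`. -/
theorem sample_two_body (φ₁ φ₂ ψ₁ ψ₂ : Hil (Fin d)) :
    opTensor 1 (create φ₁ * create φ₂ * annih ψ₂ * annih ψ₁)
      = star (sampleMode φ₁) * star (sampleMode φ₂) * (sampleMode ψ₂ * sampleMode ψ₁) := by
  rw [star_sampleMode, star_sampleMode, sampleMode, sampleMode, ← opTensor_mul, ← opTensor_mul,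
    parity_sandwich _ _ (parity_create φ₂), parity_sandwich _ _ (parity_annih ψ₁), ← opTensor_mul,
    mul_one, mul_one, ← mul_assoc]

/-- The corresponding monomials in the reservoir modes are reservoir observables. -/
theorem res_two_body (f₁ f₂ g₁ g₂ : Hil ℤ) :
    star (resMode d f₁) * star (resMode d f₂) * (resMode d g₂ * resMode d g₁)
      = opTensor (create f₁ * create f₂ * (annih g₂ * annih g₁)) 1 := by
  rw [star_resMode, star_resMode, resMode, resMode, ← opTensor_mul, ← opTensor_mul, ← opTensor_mul,
    parity_sq, mul_one]

/-! ### The coupling and its unitary group -/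

variable [NeZero d]

theorem coupling_sampleMode (φ : Hil (Fin d)) :
    coupling d * sampleMode φ - sampleMode φ * coupling d
      = (Complex.I * inner ℂ φ (ket 0)) • resMode d (ket 0) := by
  have h1 : annih (ket 0) * (annih φ * parity (Fin d)) = annih φ * parity (Fin d) * annih (ket 0) := by
    rw [mul_assoc, parity_annih, mul_neg, ← mul_assoc, annih_anti (ket 0) φ, neg_mul, mul_assoc]
  have h2 : create (ket 0) * (annih φ * parity (Fin d))
      = annih φ * parity (Fin d) * create (ket 0) + (inner ℂ φ (ket 0) : ℂ) • parity (Fin d) := by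
    have h := congrArg (· * parity (Fin d)) (car φ (ket 0))
    simp only [smul_mul_assoc, one_mul] at h
    rw [mul_assoc, parity_create, mul_neg, ← h]
    simp only [add_mul, mul_assoc]; abel
  rw [coupling, sampleMode, resMode, add_mul, mul_add, ← opTensor_mul, ← opTensor_mul,
    ← opTensor_mul, ← opTensor_mul]
  simp only [mul_one, one_mul, mul_smul_comm, smul_mul_assoc, h1, h2, smul_add, opTensor_add_right,
    opTensor_smul_right, mul_smul]
  abel

theorem coupling_resMode (f : Hil ℤ) :
    coupling d * resMode d f - resMode d f * coupling d
      = (-Complex.I * inner ℂ f (ket 0)) • sampleMode (ket 0 : Hil (Fin d)) := by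
  have h1 : create (ket 0) * annih f = (inner ℂ f (ket 0) : ℂ) • 1 - annih f * create (ket 0) := by
    rw [← car]; abel
  have neg_r : ∀ (A : Fock ℤ →L[ℂ] Fock ℤ) (B : Fock (Fin d) →L[ℂ] Fock (Fin d)),
      opTensor A (-B) = -opTensor A B := fun A B => by
    rw [← neg_one_smul ℂ B, opTensor_smul_right, neg_one_smul]
  have neg_l : ∀ (A : Fock ℤ →L[ℂ] Fock ℤ) (B : Fock (Fin d) →L[ℂ] Fock (Fin d)),
      opTensor (-A) B = -opTensor A B := fun A B => by
    rw [← neg_one_smul ℂ A, opTensor_smul_left, neg_one_smul]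
  rw [coupling, sampleMode, resMode, add_mul, mul_add, ← opTensor_mul, ← opTensor_mul,
    ← opTensor_mul, ← opTensor_mul, parity_annih, parity_create, annih_anti (ket 0) f, h1,
    sub_eq_add_neg ((inner ℂ f (ket 0) : ℂ) • (1 : Fock ℤ →L[ℂ] Fock ℤ)), opTensor_add_left,
    neg_l, neg_l, neg_r, neg_r, opTensor_smul_left, opTensor_smul_right, smul_smul]
  have : -Complex.I * inner ℂ f (ket 0) * Complex.I = inner ℂ f (ket 0) := by
    linear_combination -(inner ℂ f (ket 0) : ℂ) * Complex.I_mul_I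
  rw [this]
  abel

theorem star_coupling : star (coupling d) = coupling d := by
  rw [coupling, star_add, star_opTensor, star_opTensor, annih, annih, star_star, star_star, add_comm]

theorem star_couplingUnitary (α : ℝ) :
    star (couplingUnitary d α) = NormedSpace.exp ((Complex.I * α) • coupling d) := by
  rw [couplingUnitary, NormedSpace.star_exp, star_smul, star_coupling]
  simp

theorem couplingUnitary_isom (α : ℝ) : star (couplingUnitary d α) * couplingUnitary d α = 1 := by
  have h : (-Complex.I * α) • coupling d = -((Complex.I * α) • coupling d) := by
    rw [neg_mul, neg_smul]
  let _ : NormedAlgebra ℚ (Joint d →L[ℂ] Joint d) := NormedAlgebra.restrictScalars ℚ ℂ _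
  rw [star_couplingUnitary, couplingUnitary, h,
    ← NormedSpace.exp_add_of_commute (Commute.neg_right (Commute.refl _)), add_neg_cancel,
    NormedSpace.exp_zero]

/-- An eigenvector of the commutator with the coupling evolves by a phase. -/
theorem couplingUnitary_conj_of_eigen (α : ℝ) (c : ℂ) {C : Joint d →L[ℂ] Joint d}
    (h : coupling d * C - C * coupling d = c • C) :
    star (couplingUnitary d α) * C * couplingUnitary d α = Complex.exp (Complex.I * α * c) • C := by
  have h1 : SemiconjBy C ((Complex.I * α) • coupling d + (Complex.I * α * c) • 1)
      ((Complex.I * α) • coupling d) := by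
    change C * _ = _ * C
    rw [smul_mul_assoc, sub_eq_iff_eq_add.1 h, mul_add, mul_smul_comm, mul_smul_comm, mul_one,
      smul_add, smul_smul, add_comm]
  let _ : NormedAlgebra ℚ (Joint d →L[ℂ] Joint d) := NormedAlgebra.restrictScalars ℚ ℂ _
  have h2 := h1.exp_right
  rw [NormedSpace.exp_add_of_commute ((Commute.one_right _).smul_right _)] at h2
  have h3 : NormedSpace.exp ((Complex.I * α * c) • (1 : Joint d →L[ℂ] Joint d))
      = Complex.exp (Complex.I * α * c) • 1 := by
    rw [← Algebra.algebraMap_eq_smul_one, ← Algebra.algebraMap_eq_smul_one,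
      ← NormedSpace.algebraMap_exp_comm, Complex.exp_eq_exp_ℂ]
  rw [h3, mul_smul_comm, mul_one] at h2
  rw [star_couplingUnitary]
  have h4 : NormedSpace.exp ((Complex.I * α) • coupling d) * C
      = C * (Complex.exp (Complex.I * α * c) • NormedSpace.exp ((Complex.I * α) • coupling d)) :=
    h2.symm
  rw [h4, ← star_couplingUnitary, mul_assoc, smul_mul_assoc, couplingUnitary_isom, mul_smul_comm,
    mul_one]

end Modes

/-! ### Evolution of the modes -/

theorem secondQuant_mem_unitary {ι : Type} [LinearOrder ι] (W : Hil ι ≃ₗᵢ[ℂ] Hil ι) :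
    secondQuant W ∈ unitary (Fock ι →L[ℂ] Fock ι) := by
  refine Unitary.mem_iff.2 ⟨secondQuant_isom W, ?_⟩
  rw [secondQuant_star, secondQuant_symm]

theorem freeStep_mem_unitary {d : ℕ} (W : Hil (Fin d) ≃ₗᵢ[ℂ] Hil (Fin d)) :
    freeStep W ∈ unitary (Joint d →L[ℂ] Joint d) := by
  have h1 := Unitary.mem_iff.1 (secondQuant_mem_unitary shift)
  have h2 := Unitary.mem_iff.1 (secondQuant_mem_unitary W)
  rw [Unitary.mem_iff, freeStep, star_opTensor, ← opTensor_mul, ← opTensor_mul, h1.1, h1.2, h2.1,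
    h2.2, opTensor_one]
  exact ⟨rfl, rfl⟩

theorem freeStep_conj_sampleMode {d : ℕ} (W : Hil (Fin d) ≃ₗᵢ[ℂ] Hil (Fin d)) (φ : Hil (Fin d)) :
    star (freeStep W) * sampleMode φ * freeStep W = sampleMode (W.symm φ) := by
  have h := (Unitary.mem_iff.1 (secondQuant_mem_unitary W)).2
  rw [freeStep, sampleMode, star_opTensor, ← opTensor_mul, ← opTensor_mul, mul_one,
    secondQuant_isom, mul_smul_comm, smul_mul_assoc, sampleMode]
  have e : star (secondQuant W) * (annih φ * parity (Fin d)) * secondQuant W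
      = star (secondQuant W) * annih φ * secondQuant W
        * (star (secondQuant W) * parity (Fin d) * secondQuant W) := by
    calc _ = star (secondQuant W) * annih φ * 1 * parity (Fin d) * secondQuant W := by
          simp only [mul_assoc, mul_one]
      _ = _ := by rw [← h]; simp only [mul_assoc]
  rw [e, secondQuant_conj_annih, secondQuant_conj_parity]

theorem freeStep_conj_resMode {d : ℕ} (W : Hil (Fin d) ≃ₗᵢ[ℂ] Hil (Fin d)) (f : Hil ℤ) :
    star (freeStep W) * resMode d f * freeStep W = resMode d (shift.symm f) := by
  rw [freeStep, resMode, star_opTensor, ← opTensor_mul, ← opTensor_mul, secondQuant_conj_annih,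
    secondQuant_conj_parity, resMode]

section Evolution

variable {d : ℕ} [NeZero d]

theorem couplingUnitary_mem_unitary (α : ℝ) :
    couplingUnitary d α ∈ unitary (Joint d →L[ℂ] Joint d) := by
  refine Unitary.mem_iff.2 ⟨couplingUnitary_isom α, ?_⟩
  have h := couplingUnitary_isom (d := d) (-α)
  have e : couplingUnitary d (-α) = star (couplingUnitary d α) := by
    rw [star_couplingUnitary, couplingUnitary]; simp
  rwa [e, star_star] at h

theorem stepUnitary_mem_unitary (W : Hil (Fin d) ≃ₗᵢ[ℂ] Hil (Fin d)) (α : ℝ) :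
    stepUnitary W α ∈ unitary (Joint d →L[ℂ] Joint d) :=
  mul_mem (freeStep_mem_unitary W) (couplingUnitary_mem_unitary α)

/-- The coupling rotates `A(e₀)` and `B(Ψ₀)` into each other, since `A(e₀) ± i B(Ψ₀)` are
eigenvectors of the commutator with the generator, with eigenvalues `± 1`. -/
theorem couplingUnitary_conj_sampleMode_ket (α : ℝ) :
    star (couplingUnitary d α) * sampleMode (ket 0) * couplingUnitary d α
      = (Real.cos α : ℂ) • sampleMode (ket 0) - (Real.sin α : ℂ) • resMode d (ket 0) := by
  have hA := coupling_sampleMode (ket 0 : Hil (Fin d))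
  have hB := coupling_resMode (d := d) (ket 0)
  rw [ket_inner_ket, if_pos rfl, mul_one] at hA hB
  have hC : ∀ s : ℂ, s * s = 1 →
      coupling d * (sampleMode (ket 0) + (s * Complex.I) • resMode d (ket 0))
        - (sampleMode (ket 0) + (s * Complex.I) • resMode d (ket 0)) * coupling d
      = s • (sampleMode (ket 0) + (s * Complex.I) • resMode d (ket 0)) := by
    intro s hs
    have e : coupling d * (sampleMode (ket 0) + (s * Complex.I) • resMode d (ket 0))
        - (sampleMode (ket 0) + (s * Complex.I) • resMode d (ket 0)) * coupling d
      = (coupling d * sampleMode (ket 0) - sampleMode (ket 0) * coupling d)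
        + (s * Complex.I) • (coupling d * resMode d (ket 0) - resMode d (ket 0) * coupling d) := by
      rw [mul_add, add_mul, mul_smul_comm, smul_mul_assoc, smul_sub]; abel
    rw [e, hA, hB, smul_add, smul_smul, smul_smul, ← mul_assoc, hs, one_mul, add_comm]
    congr 2
    linear_combination -s * Complex.I_mul_I
  have h1 := couplingUnitary_conj_of_eigen α 1 (hC 1 (by ring))
  have h2 := couplingUnitary_conj_of_eigen α (-1) (hC (-1) (by ring))
  have e : (sampleMode (ket 0) : Joint d →L[ℂ] Joint d)
      = (1 / 2 : ℂ) • ((sampleMode (ket 0) + (1 * Complex.I) • resMode d (ket 0))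
        + (sampleMode (ket 0) + (-1 * Complex.I) • resMode d (ket 0))) := by module
  conv_lhs => rw [e]
  rw [mul_smul_comm, smul_mul_assoc, mul_add, add_mul, h1, h2]
  rw [Complex.ofReal_cos, Complex.ofReal_sin, Complex.cos, Complex.sin, mul_one, mul_neg_one,
    mul_comm Complex.I, neg_mul (α : ℂ) Complex.I]
  module

theorem couplingUnitary_conj_sampleMode (α : ℝ) (φ : Hil (Fin d)) :
    star (couplingUnitary d α) * sampleMode φ * couplingUnitary d α
      = sampleMode (φ + (((Real.cos α - 1 : ℝ) : ℂ) * φ 0) • ket 0)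
        + resMode d ((-(Real.sin α : ℂ) * φ 0) • ket 0) := by
  have h0 : inner ℂ (φ - φ 0 • ket 0) (ket 0 : Hil (Fin d)) = 0 := by
    rw [← inner_conj_symm, ket_inner, lp.coeFn_sub, lp.coeFn_smul, Pi.sub_apply, Pi.smul_apply]
    simp [ket]
  have h1 := coupling_sampleMode (φ - φ 0 • ket 0)
  rw [h0, mul_zero, zero_smul] at h1
  have h2 := couplingUnitary_conj_of_eigen α 0 (h1.trans (zero_smul ℂ _).symm)
  rw [mul_zero, Complex.exp_zero, one_smul] at h2
  have e : sampleMode φ = sampleMode (φ - φ 0 • ket 0) + star (φ 0) • sampleMode (ket 0) := by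
    rw [← sampleMode_smul, ← sampleMode_add, sub_add_cancel]
  have e2 : φ + (((Real.cos α - 1 : ℝ) : ℂ) * φ 0) • ket 0
      = (φ - φ 0 • ket 0) + ((Real.cos α : ℂ) * φ 0) • ket 0 := by
    push_cast; module
  rw [e, mul_add, add_mul, h2, mul_smul_comm, smul_mul_assoc, couplingUnitary_conj_sampleMode_ket,
    e2, sampleMode_add, sampleMode_smul, resMode_smul]
  simp only [star_mul', star_neg, Complex.star_def, Complex.conj_ofReal]
  module

/-- Reservoir modes away from the contact site are not affected by the coupling. -/
theorem couplingUnitary_conj_resMode (α : ℝ) (f : Hil ℤ) (hf : f 0 = 0) :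
    star (couplingUnitary d α) * resMode d f * couplingUnitary d α = resMode d f := by
  have h1 := coupling_resMode (d := d) f
  have h0 : inner ℂ f (ket 0 : Hil ℤ) = 0 := by
    rw [← inner_conj_symm, ket_inner, hf, map_zero]
  rw [h0, mul_zero, zero_smul, ← zero_smul ℂ (resMode d f)] at h1
  have h2 := couplingUnitary_conj_of_eigen α 0 h1
  rwa [mul_zero, Complex.exp_zero, one_smul] at h2

theorem star_oneStepMatrix_apply (W : Hil (Fin d) ≃ₗᵢ[ℂ] Hil (Fin d)) (α : ℝ) (φ : Hil (Fin d)) :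
    star (oneStepMatrix W α) φ
      = W.symm φ + (((Real.cos α - 1 : ℝ) : ℂ) * (W.symm φ) 0) • ket 0 := by
  refine ext_inner_left ℂ fun ψ => ?_
  have hW : ∀ x, inner ℂ (W x) φ = inner ℂ x (W.symm φ) := fun x => by
    conv_lhs => rw [← W.apply_symm_apply φ]
    exact W.inner_map_map x _
  rw [ContinuousLinearMap.star_eq_adjoint, ContinuousLinearMap.adjoint_inner_right, oneStepMatrix]
  change inner ℂ (W (ψ + ((Real.cos α - 1 : ℝ) : ℂ) • InnerProductSpace.rankOne ℂ (ket 0) (ket 0) ψ))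
    φ = _
  rw [hW, InnerProductSpace.rankOne_apply, inner_add_left, inner_add_right, inner_smul_left,
    inner_smul_left, inner_smul_right, Complex.conj_ofReal, inner_conj_symm, ket_inner]
  ring

theorem stepUnitary_conj (W : Hil (Fin d) ≃ₗᵢ[ℂ] Hil (Fin d)) (α : ℝ) (φ : Hil (Fin d))
    (f : Hil ℤ) (hf : f (-1) = 0) :
    star (stepUnitary W α) * (sampleMode φ + resMode d f) * stepUnitary W α
      = sampleMode (star (oneStepMatrix W α) φ)
        + resMode d ((-(Real.sin α : ℂ) * W.symm φ 0) • ket 0 + shift.symm f) := by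
  have e : star (stepUnitary W α) * (sampleMode φ + resMode d f) * stepUnitary W α
      = star (couplingUnitary d α) * (star (freeStep W) * sampleMode φ * freeStep W)
          * couplingUnitary d α
        + star (couplingUnitary d α) * (star (freeStep W) * resMode d f * freeStep W)
          * couplingUnitary d α := by
    rw [stepUnitary, star_mul]; simp only [mul_add, add_mul, mul_assoc]
  -- `(S⁻¹ f)(0) = f(-1)`, so the shifted vector does not see the coupling
  have h0 : shift.symm f 0 = 0 := hf
  rw [e, freeStep_conj_sampleMode, freeStep_conj_resMode, couplingUnitary_conj_sampleMode,
    couplingUnitary_conj_resMode α _ h0, star_oneStepMatrix_apply, resMode_add, add_assoc]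

/-- The one-particle form of the evolution. What has left the sample sits on sites `j ≥ 0` of the
reservoir and moves to the right, so that it never meets the sample again. -/
theorem exists_evolve_sampleMode (W : Hil (Fin d) ≃ₗᵢ[ℂ] Hil (Fin d)) (α : ℝ) (φ : Hil (Fin d))
    (t : ℕ) : ∃ f : Hil ℤ, (∀ j < 0, f j = 0) ∧
      star (stepUnitary W α) ^ t * sampleMode φ * stepUnitary W α ^ t
        = sampleMode ((star (oneStepMatrix W α) ^ t) φ) + resMode d f := by
  induction t with
  | zero =>
    refine ⟨0, fun _ _ => rfl, ?_⟩
    have : resMode d (0 : Hil ℤ) = 0 := by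
      simpa using resMode_smul (d := d) 0 (0 : Hil ℤ)
    simp [this]
  | succ t ih =>
    obtain ⟨f, hf, h⟩ := ih
    refine ⟨(-(Real.sin α : ℂ) * W.symm ((star (oneStepMatrix W α) ^ t) φ) 0) • ket 0
      + shift.symm f, ?_, ?_⟩
    · intro j hj
      have h1 : shift.symm f j = 0 := hf (j + -1) (by lia)
      rw [lp.coeFn_add, lp.coeFn_smul, Pi.add_apply, Pi.smul_apply, h1, ket, lp.single_apply,
        Pi.single_eq_of_ne hj.ne]
      simp
    · rw [pow_succ', pow_succ, pow_succ']
      calc _ = star (stepUnitary W α) * (star (stepUnitary W α) ^ t * sampleMode φ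
            * stepUnitary W α ^ t) * stepUnitary W α := by simp only [mul_assoc]
        _ = _ := by rw [h, stepUnitary_conj W α _ f (hf _ (by norm_num))]; rfl

/-- The reservoir vector `f_t` in `U*ᵗ A(φ) Uᵗ = A(M*ᵗ φ) + B(f_t)`: the part of the evolved mode that
has left the sample. It is chosen from the existence statement; only this equation is used. -/
noncomputable def emitted (W : Hil (Fin d) ≃ₗᵢ[ℂ] Hil (Fin d)) (α : ℝ) (t : ℕ)
    (φ : Hil (Fin d)) : Hil ℤ :=
  (exists_evolve_sampleMode W α φ t).choose

theorem evolve_sampleMode (W : Hil (Fin d) ≃ₗᵢ[ℂ] Hil (Fin d)) (α : ℝ) (t : ℕ)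
    (φ : Hil (Fin d)) :
    star (stepUnitary W α) ^ t * sampleMode φ * stepUnitary W α ^ t
      = sampleMode ((star (oneStepMatrix W α) ^ t) φ) + resMode d (emitted W α t φ) :=
  (exists_evolve_sampleMode W α φ t).choose_spec.2

instance : Nontrivial (Joint d →L[ℂ] Joint d) := by
  -- the vacuum vector `Ω ⊗ Ω` is not zero
  refine ⟨1, 0, fun h => ?_⟩
  have h1 := congrArg (fun A : Joint d →L[ℂ] Joint d =>
    (inner ℂ (tmul (occ ∅) (occ ∅)) (A (tmul (occ ∅) (occ ∅))) : ℂ)) h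
  simp [tmul_inner, occ_inner, occ_apply, -inner_self_eq_norm_sq_to_K] at h1

/-- Conservation of the one-particle inner product, read off from the anticommutation relations. -/
theorem emitted_inner (W : Hil (Fin d) ≃ₗᵢ[ℂ] Hil (Fin d)) (α : ℝ) (t : ℕ) (φ ψ : Hil (Fin d)) :
    inner ℂ (emitted W α t φ) (emitted W α t ψ)
      = (inner ℂ φ ψ - inner ℂ ((star (oneStepMatrix W α) ^ t) φ)
          ((star (oneStepMatrix W α) ^ t) ψ) : ℂ) := by
  have hU := Unitary.mem_iff.1 (pow_mem (stepUnitary_mem_unitary W α) t)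
  have h1 := evolve_sampleMode W α t φ
  have h2 := congrArg star (evolve_sampleMode W α t ψ)
  rw [← star_pow] at h1 h2
  set V := stepUnitary W α ^ t
  set N := star (oneStepMatrix W α) ^ t
  have key : ∀ X Y : Joint d →L[ℂ] Joint d, star V * X * V * (star V * Y * V)
      = star V * (X * Y) * V := fun X Y => by
    calc _ = star V * X * (V * star V) * Y * V := by simp only [mul_assoc]
      _ = _ := by rw [hU.2, mul_one]; simp only [mul_assoc]
  have h3 : star V * star (sampleMode ψ) * V
      = star (sampleMode (N ψ)) + star (resMode d (emitted W α t ψ)) := by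
    rw [← star_add, ← h2, star_mul, star_mul, star_star, mul_assoc]
  have h4 := congrArg (fun X => star V * X * V) (sampleMode_car φ ψ)
  -- evolve `{A(φ), A(ψ)*} = ⟨φ, ψ⟩`; the mixed anticommutators vanish
  have h5 : (inner ℂ φ ψ : ℂ) • (1 : Joint d →L[ℂ] Joint d)
      = (inner ℂ (N φ) (N ψ) : ℂ) • 1
        + (inner ℂ (emitted W α t φ) (emitted W α t ψ) : ℂ) • 1 := by
    have e : star V * ((inner ℂ φ ψ : ℂ) • (1 : Joint d →L[ℂ] Joint d)) * V
        = (inner ℂ φ ψ : ℂ) • 1 := by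
      rw [mul_smul_comm, smul_mul_assoc, mul_one, hU.1]
    rw [← e, ← h4]
    simp only [mul_add, add_mul (star V * _)]
    rw [← key, ← key, h1, h3, ← sampleMode_car, ← resMode_car]
    have c1 := sampleMode_resMode_car (N φ) (emitted W α t ψ)
    have c2 := resMode_sampleMode_car (emitted W α t φ) (N ψ)
    rw [← add_zero (_ + _ + (_ + _)), ← c1, ← add_zero (_ + _ + (_ + _) + _), ← c2]
    simp only [mul_add, add_mul]
    abel
  rw [← add_smul] at h5
  have h6 := smul_left_injective ℂ (one_ne_zero (α := Joint d →L[ℂ] Joint d)) h5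
  rw [h6]; ring

/-! ### Decay of the sample component -/

/-- `M` is a contraction, because the emitted vector has nonnegative squared norm. -/
theorem norm_star_oneStepMatrix_le (W : Hil (Fin d) ≃ₗᵢ[ℂ] Hil (Fin d)) (α : ℝ) :
    ‖star (oneStepMatrix W α)‖ ≤ 1 := by
  refine ContinuousLinearMap.opNorm_le_bound _ zero_le_one fun φ => ?_
  have h := emitted_inner W α 1 φ φ
  simp only [inner_self_eq_norm_sq_to_K, pow_one] at h
  have h2 : ‖emitted W α 1 φ‖ ^ 2 = ‖φ‖ ^ 2 - ‖star (oneStepMatrix W α) φ‖ ^ 2 := by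
    apply Complex.ofReal_injective; push_cast; exact h
  rw [one_mul]
  exact abs_le_of_sq_le_sq' (by nlinarith [sq_nonneg ‖emitted W α 1 φ‖]) (norm_nonneg _) |>.2

/-- In finite dimension a contraction without spectrum on the unit circle has spectral radius less
than one, hence its powers tend to zero. -/
theorem tendsto_star_oneStepMatrix_pow (W : Hil (Fin d) ≃ₗᵢ[ℂ] Hil (Fin d)) (α : ℝ)
    (hM : Disjoint (spectrum ℂ (oneStepMatrix W α)) (Metric.sphere (0 : ℂ) 1)) :
    Tendsto (fun t : ℕ => star (oneStepMatrix W α) ^ t) atTop (𝓝 0) := by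
  set M := oneStepMatrix W α
  have : Nontrivial (Hil (Fin d)) := ⟨ket 0, 0, fun h => by
    simpa [ket] using congrArg (fun f : Hil (Fin d) => f 0) h⟩
  have hnorm : ‖M‖ ≤ 1 := by rw [← norm_star]; exact norm_star_oneStepMatrix_le W α
  have hr : spectralRadius ℂ M < 1 := by
    obtain ⟨z, hz, hzr⟩ := spectrum.exists_nnnorm_eq_spectralRadius M
    have h1 : ‖z‖ ≠ 1 := fun h => Set.disjoint_left.1 hM hz (by simpa using h)
    have h2 : ‖z‖ ≤ 1 := (spectrum.norm_le_norm_of_mem hz).trans hnorm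
    rw [← hzr]
    exact_mod_cast lt_of_le_of_ne h2 h1
  -- Gelfand's formula gives `‖Mⁿ‖ ≤ rⁿ` eventually, for any `r` above the spectral radius
  obtain ⟨r, hr1, hr2⟩ := exists_between hr
  have hg := spectrum.pow_nnnorm_pow_one_div_tendsto_nhds_spectralRadius M
  have hev : ∀ᶠ n : ℕ in atTop, (‖M ^ n‖₊ : ENNReal) ≤ r ^ n := by
    filter_upwards [hg.eventually_lt_const hr1, eventually_gt_atTop 0] with n hn hn0
    have hn' : (0 : ℝ) < n := by exact_mod_cast hn0
    have := ENNReal.rpow_le_rpow hn.le hn'.le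
    rwa [← ENNReal.rpow_mul, one_div, inv_mul_cancel₀ hn'.ne', ENNReal.rpow_one,
      ENNReal.rpow_natCast] at this
  have h0 : Tendsto (fun n : ℕ => (‖M ^ n‖₊ : ENNReal)) atTop (𝓝 0) :=
    tendsto_of_tendsto_of_tendsto_of_le_of_le' tendsto_const_nhds
      (ENNReal.tendsto_pow_atTop_nhds_zero_of_lt_one hr2) (Eventually.of_forall fun _ => bot_le) hev
  have h1 : Tendsto (fun n : ℕ => ‖M ^ n‖) atTop (𝓝 0) :=
    (ENNReal.tendsto_toReal ENNReal.zero_ne_top).comp h0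
  rw [tendsto_zero_iff_norm_tendsto_zero]
  refine h1.congr fun n => ?_
  rw [← star_pow]
  exact (norm_star _).symm

end Evolution

/-! ### Continuity of the initial state -/

/-- A positive functional on a C⋆-algebra is bounded. -/
theorem IsState.continuous {ω : carAlg ℤ →ₗ[ℂ] ℂ} (hω : IsState ω) : Continuous ω := by
  have : IsClosed (carAlg ℤ : Set (Fock ℤ →L[ℂ] Fock ℤ)) := carAlg_isClosed ℤ
  let _ : PartialOrder (carAlg ℤ) := CStarAlgebra.spectralOrder _
  have : StarOrderedRing (carAlg ℤ) := CStarAlgebra.spectralOrderedRing _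
  let f : carAlg ℤ →ₚ[ℂ] ℂ := PositiveLinearMap.mk₀ ω fun x hx => by
    obtain ⟨y, rfl⟩ := CStarAlgebra.nonneg_iff_eq_star_mul_self.1 hx
    exact hω.nonneg y
  obtain ⟨C, hC⟩ := f.exists_norm_apply_le
  exact (ω.mkContinuous C hC).continuous

theorem prodState_sub {d : ℕ} (ω : carAlg ℤ →ₗ[ℂ] ℂ) (ρ : Fock (Fin d) →L[ℂ] Fock (Fin d))
    (X Y : jointAlg d) : prodState ω ρ (X - Y) = prodState ω ρ X - prodState ω ρ Y := by
  have h : ∀ S T, blockRes (X - Y) S T = blockRes X S T - blockRes Y S T := by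
    intro S T
    apply Subtype.ext
    change block S T ((X : Joint d →L[ℂ] Joint d) - Y) = block S T (X : Joint d →L[ℂ] Joint d)
      - block S T (Y : Joint d →L[ℂ] Joint d)
    ext f : 1
    simp [block]
  simp only [prodState, h, map_sub, mul_sub, Finset.sum_sub_distrib]

theorem prodState_continuous {d : ℕ} {ω : carAlg ℤ →ₗ[ℂ] ℂ} (hω : IsState ω)
    (ρ : Fock (Fin d) →L[ℂ] Fock (Fin d)) : Continuous (prodState ω ρ) := by
  have h : ∀ S T, Continuous fun X : jointAlg d => blockRes X S T := fun S T =>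
    ((block_continuous S T).comp continuous_subtype_val).subtype_mk _
  have := hω.continuous
  unfold prodState
  fun_prop

/-- On a reservoir observable the product state is the reservoir state. -/
theorem prodState_opTensor_one {d : ℕ} (ω : carAlg ℤ →ₗ[ℂ] ℂ)
    {ρ : Fock (Fin d) →L[ℂ] Fock (Fin d)} (hρ : IsDensityMatrix ρ) (A : carAlg ℤ) :
    prodState ω ρ ⟨opTensor (A : Fock ℤ →L[ℂ] Fock ℤ) 1, opTensor_mem A.2 1⟩ = ω A := by
  have h : ∀ S T : Finset (Fin d), blockRes ⟨opTensor (A : Fock ℤ →L[ℂ] Fock ℤ) 1,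
      opTensor_mem A.2 1⟩ S T = (if S = T then (1 : ℂ) else 0) • A := by
    intro S T
    apply Subtype.ext
    change block S T (opTensor (A : Fock ℤ →L[ℂ] Fock ℤ) 1) = _
    rw [block_opTensor]
    change (inner ℂ (occ S) (occ T) : ℂ) • _ = _
    rw [occ_inner, occ_apply]; rfl
  have hb : Orthonormal ℂ (occ : Finset (Fin d) → Fock (Fin d)) := by
    rw [orthonormal_iff_ite]
    intro S T
    rw [occ_inner, occ_apply]
  have hspan : ⊤ ≤ Submodule.span ℂ (Set.range (occ : Finset (Fin d) → Fock (Fin d))) := by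
    intro f _
    rw [fin_expand f]
    exact Submodule.sum_mem _ fun S _ => Submodule.smul_mem _ _ (Submodule.subset_span ⟨S, rfl⟩)
  have ht := LinearMap.trace_eq_sum_inner ρ.toLinearMap (OrthonormalBasis.mk hb hspan)
  rw [hρ.trace_one] at ht
  simp only [prodState, h, map_smul, smul_eq_mul, ite_mul, one_mul, zero_mul, mul_ite, mul_zero,
    Finset.sum_ite_eq, Finset.mem_univ, if_true]
  rw [← Finset.sum_mul]
  simp only [OrthonormalBasis.coe_mk] at ht
  have ht' : ∑ S : Finset (Fin d), (inner ℂ (occ S) (ρ (occ S)) : ℂ) = 1 := ht.symm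
  rw [ht', one_mul]

/-- The two-particle moments, the `2 × 2` determinant written out. -/
theorem IsQuasiFree.two_body {ω : carAlg ℤ →ₗ[ℂ] ℂ} {Sig : Hil ℤ →L[ℂ] Hil ℤ}
    (hω : IsQuasiFree ω Sig) (f₁ f₂ g₁ g₂ : Hil ℤ) :
    ω (resCreate f₁ * resCreate f₂ * (resAnnih g₂ * resAnnih g₁))
      = inner ℂ g₁ (Sig f₁) * inner ℂ g₂ (Sig f₂) - inner ℂ g₁ (Sig f₂) * inner ℂ g₂ (Sig f₁) := by
  have h := hω.moments 2 ![f₂, f₁] ![g₂, g₁]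
  rw [Matrix.det_fin_two] at h
  simp [List.ofFn_succ] at h
  rw [h]; ring

/-! ### Convergence of the matrix elements -/

theorem tendsto_mul_sub_mul {A : Type*} [NormedRing A] {x y x' y' : ℕ → A} {C C' : ℝ}
    (hx : ∀ n, ‖x n‖ ≤ C) (hy' : ∀ n, ‖y' n‖ ≤ C')
    (h : Tendsto (fun n => x n - y n) atTop (𝓝 0))
    (h' : Tendsto (fun n => x' n - y' n) atTop (𝓝 0)) :
    Tendsto (fun n => x n * x' n - y n * y' n) atTop (𝓝 0) := by
  have e : ∀ n, x n * x' n - y n * y' n = x n * (x' n - y' n) + (x n - y n) * y' n := fun n => by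
    noncomm_ring
  simp only [e]
  rw [← add_zero (0 : A)]
  refine Tendsto.add ?_ ?_
  · exact isBoundedUnder_le_mul_tendsto_zero
      (isBoundedUnder_of ⟨C, fun n => hx n⟩) h'
  · exact h.zero_mul_isBoundedUnder_le
      (isBoundedUnder_of ⟨C', fun n => hy' n⟩)

section Limit

variable {d : ℕ}

theorem norm_opTensor_le (A : Fock ℤ →L[ℂ] Fock ℤ) (B : Fock (Fin d) →L[ℂ] Fock (Fin d)) :
    ‖opTensor A B‖ ≤ ‖A‖ * ‖B‖ :=
  TensorProduct.norm_mapL_le A B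

theorem norm_annih_le {ι : Type} [LinearOrder ι] (φ : Hil ι) : ‖annih φ‖ ≤ ‖φ‖ := by
  exact (norm_star (create φ)).trans_le (mkOp_norm _ _ _ _)

theorem norm_resMode_le (f : Hil ℤ) : ‖resMode d f‖ ≤ ‖f‖ * ‖parity (Fin d)‖ := by
  refine (norm_opTensor_le _ _).trans ?_
  gcongr
  exact norm_annih_le f

theorem norm_sampleMode_le (φ : Hil (Fin d)) :
    ‖sampleMode φ‖ ≤ ‖(1 : Fock ℤ →L[ℂ] Fock ℤ)‖ * (‖φ‖ * ‖parity (Fin d)‖) := by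
  refine (norm_opTensor_le _ _).trans ?_
  rw [norm_smul, Complex.norm_I, one_mul]
  gcongr
  refine (norm_mul_le _ _).trans ?_
  gcongr
  exact norm_annih_le φ

variable [NeZero d] (W : Hil (Fin d) ≃ₗᵢ[ℂ] Hil (Fin d)) (α : ℝ)

theorem norm_emitted_le (t : ℕ) (φ : Hil (Fin d)) : ‖emitted W α t φ‖ ≤ ‖φ‖ := by
  have h := emitted_inner W α t φ φ
  simp only [inner_self_eq_norm_sq_to_K] at h
  have h2 : ‖emitted W α t φ‖ ^ 2 = ‖φ‖ ^ 2 - ‖(star (oneStepMatrix W α) ^ t) φ‖ ^ 2 := by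
    apply Complex.ofReal_injective
    simp only [Complex.ofReal_sub, Complex.ofReal_pow]
    exact h
  exact abs_le_of_sq_le_sq' (by nlinarith [sq_nonneg ‖(star (oneStepMatrix W α) ^ t) φ‖])
    (norm_nonneg _) |>.2

variable {W α}

theorem tendsto_emitted_inner
    (hN : Tendsto (fun t : ℕ => star (oneStepMatrix W α) ^ t) atTop (𝓝 0)) (φ ψ : Hil (Fin d)) :
    Tendsto (fun t : ℕ => (inner ℂ (emitted W α t φ) (emitted W α t ψ) : ℂ)) atTop
      (𝓝 (inner ℂ φ ψ)) := by
  have h : ∀ φ : Hil (Fin d), Tendsto (fun t : ℕ => (star (oneStepMatrix W α) ^ t) φ) atTop (𝓝 0) :=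
    fun φ => ((ContinuousLinearMap.apply ℂ (Hil (Fin d)) φ).continuous.tendsto 0).comp hN
  simp only [emitted_inner]
  simpa using ((h φ).inner (𝕜 := ℂ) (h ψ)).const_sub (inner ℂ φ ψ)

/-- The evolved mode is asymptotically a pure reservoir mode. -/
theorem tendsto_evolve_sampleMode
    (hN : Tendsto (fun t : ℕ => star (oneStepMatrix W α) ^ t) atTop (𝓝 0)) (φ : Hil (Fin d)) :
    Tendsto (fun t : ℕ => star (stepUnitary W α) ^ t * sampleMode φ * stepUnitary W α ^ t
      - resMode d (emitted W α t φ)) atTop (𝓝 0) := by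
  have h : Tendsto (fun t : ℕ => (star (oneStepMatrix W α) ^ t) φ) atTop (𝓝 0) :=
    ((ContinuousLinearMap.apply ℂ (Hil (Fin d)) φ).continuous.tendsto 0).comp hN
  simp only [evolve_sampleMode, add_sub_cancel_right]
  refine squeeze_zero_norm (fun t => norm_sampleMode_le _) ?_
  simpa using (h.norm.mul_const ‖parity (Fin d)‖).const_mul ‖(1 : Fock ℤ →L[ℂ] Fock ℤ)‖

/-- The evolved two-body observable is asymptotically a reservoir observable, in norm. -/
theorem tendsto_evolve_two_body
    (hN : Tendsto (fun t : ℕ => star (oneStepMatrix W α) ^ t) atTop (𝓝 0))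
    (φ₁ φ₂ ψ₁ ψ₂ : Hil (Fin d)) :
    Tendsto (fun t : ℕ => star (stepUnitary W α) ^ t
        * opTensor 1 (create φ₁ * create φ₂ * annih ψ₂ * annih ψ₁) * stepUnitary W α ^ t
      - opTensor (create (emitted W α t φ₁) * create (emitted W α t φ₂)
          * (annih (emitted W α t ψ₂) * annih (emitted W α t ψ₁))) 1) atTop (𝓝 0) := by
  set E : Hil (Fin d) → ℕ → Joint d →L[ℂ] Joint d := fun φ t =>
    star (stepUnitary W α) ^ t * sampleMode φ * stepUnitary W α ^ t with hE
  set B : Hil (Fin d) → ℕ → Joint d →L[ℂ] Joint d := fun φ t =>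
    resMode d (emitted W α t φ) with hB
  have hU : ∀ t, stepUnitary W α ^ t ∈ unitary (Joint d →L[ℂ] Joint d) := fun t =>
    pow_mem (stepUnitary_mem_unitary W α) t
  have hconv : ∀ φ, Tendsto (fun t => E φ t - B φ t) atTop (𝓝 0) := tendsto_evolve_sampleMode hN
  have hconv' : ∀ φ, Tendsto (fun t => star (E φ t) - star (B φ t)) atTop (𝓝 0) := fun φ => by
    have h := (continuous_star.tendsto (0 : Joint d →L[ℂ] Joint d)).comp (hconv φ)
    rw [star_zero] at h
    exact h.congr fun t => star_sub _ _
  have hEn : ∀ φ t, ‖E φ t‖ ≤ ‖sampleMode φ‖ := fun φ t => by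
    rw [hE]
    simp only [← star_pow]
    rw [CStarRing.norm_mul_mem_unitary _ (hU t),
      CStarRing.norm_mem_unitary_mul _ (Unitary.star_mem (hU t))]
  have hBn : ∀ φ t, ‖B φ t‖ ≤ ‖φ‖ * ‖parity (Fin d)‖ := fun φ t =>
    (norm_resMode_le _).trans (by gcongr; exact norm_emitted_le W α t φ)
  have hB' : ∀ φ t, ‖star (B φ t)‖ ≤ ‖φ‖ * ‖parity (Fin d)‖ := fun φ t => by
    rw [norm_star]; exact hBn φ t
  have hE' : ∀ φ t, ‖star (E φ t)‖ ≤ ‖sampleMode φ‖ := fun φ t => by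
    rw [norm_star]; exact hEn φ t
  have hmul : ∀ {x y : ℕ → Joint d →L[ℂ] Joint d} {a b : ℝ}, 0 ≤ a → (∀ t, ‖x t‖ ≤ a) →
      (∀ t, ‖y t‖ ≤ b) → ∀ t, ‖x t * y t‖ ≤ a * b := fun h0 h1 h2 t =>
    (norm_mul_le _ _).trans (mul_le_mul (h1 t) (h2 t) (norm_nonneg _) h0)
  have h12 := tendsto_mul_sub_mul (hE' φ₁) (hB' φ₂) (hconv' φ₁) (hconv' φ₂)
  have h34 := tendsto_mul_sub_mul (hEn ψ₂) (hBn ψ₁) (hconv ψ₂) (hconv ψ₁)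
  have h := tendsto_mul_sub_mul (hmul (norm_nonneg _) (hE' φ₁) (hE' φ₂))
    (hmul (by positivity) (hBn ψ₂) (hBn ψ₁)) h12 h34
  refine h.congr fun t => ?_
  rw [← res_two_body, sample_two_body]
  congr 1
  have hU' := (Unitary.mem_iff.1 (hU t)).2
  simp only [hE, ← star_pow]
  set V := stepUnitary W α ^ t
  have key : ∀ X Y : Joint d →L[ℂ] Joint d, star V * X * V * (star V * Y * V)
      = star V * (X * Y) * V := fun X Y => by
    calc _ = star V * X * (V * star V) * Y * V := by simp only [mul_assoc]
      _ = _ := by rw [hU', mul_one]; simp only [mul_assoc]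
  have hs : ∀ X : Joint d →L[ℂ] Joint d, star (star V * X * V) = star V * star X * V := fun X => by
    rw [star_mul, star_mul, star_star, mul_assoc]
  rw [hs, hs, key, key, key]

theorem tendsto_rdmEntry {σ : ℝ} {ω : carAlg ℤ →ₗ[ℂ] ℂ} (hω : IsQuasiFree ω ((σ : ℂ) • 1))
    {ρ : Fock (Fin d) →L[ℂ] Fock (Fin d)} (hρ : IsDensityMatrix ρ)
    (hN : Tendsto (fun t : ℕ => star (oneStepMatrix W α) ^ t) atTop (𝓝 0)) (j₁ j₂ k₁ k₂ : Fin d) :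
    Tendsto (fun t => rdmEntry W α ω ρ t j₁ j₂ k₁ k₂) atTop
      (𝓝 ((σ : ℂ) ^ 2 * inner ℂ (wedge2 (ket j₁) (ket j₂)) (wedge2 (ket k₁) (ket k₂)))) := by
  set F : Fin d → ℕ → Hil ℤ := fun j t => emitted W α t (ket j)
  let R : ℕ → carAlg ℤ := fun t => resCreate (F k₁ t) * resCreate (F k₂ t)
    * (resAnnih (F j₂ t) * resAnnih (F j₁ t))
  have hcr : ∀ f, ((resCreate f : carAlg ℤ) : Fock ℤ →L[ℂ] Fock ℤ) = create f := fun f =>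
    star_star (create f)
  have hR : ∀ t, (R t : Fock ℤ →L[ℂ] Fock ℤ) = create (F k₁ t) * create (F k₂ t)
      * (annih (F j₂ t) * annih (F j₁ t)) := fun t => by
    change (resCreate (F k₁ t) : Fock ℤ →L[ℂ] Fock ℤ) * (resCreate (F k₂ t) : Fock ℤ →L[ℂ] Fock ℤ)
      * (annih (F j₂ t) * annih (F j₁ t)) = _
    rw [hcr, hcr]
  let X : ℕ → jointAlg d := fun t => evolve W α t (sampleObs
    (create (ket k₁) * create (ket k₂) * annih (ket j₂) * annih (ket j₁)))
  let Y : ℕ → jointAlg d := fun t => ⟨opTensor (R t : Fock ℤ →L[ℂ] Fock ℤ) 1, opTensor_mem (R t).2 1⟩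
  have h1 : Tendsto (fun t => X t - Y t) atTop (𝓝 0) := by
    rw [tendsto_subtype_rng]
    refine (tendsto_evolve_two_body hN (ket k₁) (ket k₂) (ket j₁) (ket j₂)).congr fun t => ?_
    rw [← hR]; rfl
  have h2 : Tendsto (fun t => prodState ω ρ (X t) - ω (R t)) atTop (𝓝 0) := by
    have h0 : prodState ω ρ 0 = 0 := by simpa using prodState_sub ω ρ 0 0
    have h := ((prodState_continuous hω.toIsState ρ).tendsto 0).comp h1
    rw [h0] at h
    refine h.congr fun t => ?_
    rw [Function.comp_apply, prodState_sub, prodState_opTensor_one ω hρ]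
  have h3 : Tendsto (fun t => ω (R t)) atTop
      (𝓝 ((σ : ℂ) ^ 2 * inner ℂ (wedge2 (ket j₁) (ket j₂)) (wedge2 (ket k₁) (ket k₂)))) := by
    have hi : ∀ j k : Fin d, Tendsto (fun t => (inner ℂ (F j t) (((σ : ℂ) • (1 : Hil ℤ →L[ℂ] Hil ℤ))
        (F k t)) : ℂ)) atTop (𝓝 (σ * if j = k then 1 else 0)) := fun j k => by
      rw [← ket_inner_ket]
      refine ((tendsto_emitted_inner hN (ket j) (ket k)).const_mul (σ : ℂ)).congr fun t => ?_
      rw [_root_.smul_apply, one_apply_eq_self, inner_smul_right]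
    have h := ((hi j₁ k₁).mul (hi j₂ k₂)).sub ((hi j₁ k₂).mul (hi j₂ k₁))
    simp only [← hω.two_body] at h
    refine h.trans_eq ?_
    rw [wedge2_inner]
    congr 1; ring
  have h4 := h2.add h3
  simp only [sub_add_cancel, zero_add] at h4
  exact h4

end Limit

/-! ### Operators on the antisymmetric two-particle space -/

section Wedge

variable {d : ℕ}

theorem exchange_sq : exchange d * exchange d = 1 := by
  ext z
  refine htensor_induction (p := fun z => (exchange d * exchange d) z = (1 : Pair d →L[ℂ] Pair d) z) z
    ?_ ?_ ?_
  · simp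
  · intro x y; rfl
  · intro x y hx hy; rw [map_add, map_add, hx, hy]

theorem antisymProj_sq : antisymProj d * antisymProj d = antisymProj d := by
  rw [antisymProj, smul_mul_smul_comm, sub_mul, mul_sub, mul_sub, exchange_sq, one_mul, one_mul,
    mul_one]
  module

theorem antisymProj_apply (z : Wedge2 d) : antisymProj d (z : Pair d) = z := by
  obtain ⟨_, y, rfl⟩ := z
  exact congrArg (fun A : Pair d →L[ℂ] Pair d => A y) antisymProj_sq

theorem compress_smul_one (c : ℂ) :
    compress (c • (1 : Pair d →L[ℂ] Pair d)) = c • (1 : Wedge2 d →L[ℂ] Wedge2 d) := by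
  refine ContinuousLinearMap.ext fun z => Subtype.ext ?_
  change antisymProj d (c • antisymProj d (z : Pair d)) = c • (z : Pair d)
  rw [map_smul, antisymProj_apply, antisymProj_apply]

theorem span_wedge2_ket :
    Submodule.span ℂ (Set.range fun p : Fin d × Fin d => wedge2 (ket p.1) (ket p.2)) = ⊤ := by
  rw [eq_top_iff]
  rintro ⟨_, y, rfl⟩ -
  set P : Pair d →ₗ[ℂ] Wedge2 d := (antisymProj d).toLinearMap.rangeRestrict with hP
  change P y ∈ _
  have hw : ∀ u v : Hil (Fin d), P (tmul u v) = ((1 / Real.sqrt 2 : ℝ) : ℂ) • wedge2 u v := by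
    intro u v
    have h2 : ((1 / Real.sqrt 2 : ℝ) : ℂ) * ((1 / Real.sqrt 2 : ℝ) : ℂ) = 1 / 2 := by
      rw [← Complex.ofReal_mul, div_mul_div_comm, Real.mul_self_sqrt (by norm_num)]; norm_num
    apply Subtype.ext
    change (1 / 2 : ℂ) • (tmul u v - tmul v u)
      = ((1 / Real.sqrt 2 : ℝ) : ℂ) • ((1 / Real.sqrt 2 : ℝ) : ℂ) • (tmul u v - tmul v u)
    rw [smul_smul, h2]
  refine htensor_induction (p := fun y => P y ∈ _) y ?_ ?_ ?_
  · rw [map_zero]; exact zero_mem _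
  · intro u v
    have e : tmul u v = ∑ i, ∑ j, (u i * v j) • (tmul (ket i) (ket j) : Pair d) := by
      conv_lhs => rw [fin_expand u, fin_expand v, ← tmulL_apply]
      simp only [map_sum, map_smul, _root_.sum_apply, _root_.smul_apply, tmulL_apply,
        Finset.smul_sum, smul_smul]
      rw [Finset.sum_comm]
      simp only [mul_comm]
    rw [e]
    simp only [map_sum, map_smul, hw]
    exact Submodule.sum_mem _ fun i _ => Submodule.sum_mem _ fun j _ => Submodule.smul_mem _ _
      (Submodule.smul_mem _ _ (Submodule.subset_span ⟨(i, j), rfl⟩))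
  · intro x y hx hy
    rw [map_add]; exact add_mem hx hy

/-- The vectors `e_j ∧ e_k`, `j < k`, resolve the identity of `H ∧ H`. -/
theorem sum_rankOne_wedge2 (c : ℂ) :
    ∑ j₁ : Fin d, ∑ j₂ ∈ Finset.Ioi j₁, ∑ k₁ : Fin d, ∑ k₂ ∈ Finset.Ioi k₁,
      (c * inner ℂ (wedge2 (ket j₁) (ket j₂)) (wedge2 (ket k₁) (ket k₂))) •
        InnerProductSpace.rankOne ℂ (wedge2 (ket j₁) (ket j₂)) (wedge2 (ket k₁) (ket k₂))
      = c • (1 : Wedge2 d →L[ℂ] Wedge2 d) := by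
  have dl : ∀ x y : Fin d, (if x = y then (1 : ℂ) else 0) = if y = x then 1 else 0 := fun x y => by
    simp only [eq_comm]
  -- both sides have the same matrix elements between the spanning vectors `e_a ∧ e_b`
  refine ContinuousLinearMap.coe_injective (LinearMap.ext_on_range span_wedge2_ket fun q => ?_)
  rw [← sub_eq_zero]
  refine Submodule.mem_bot ℂ |>.1 ?_
  rw [← Submodule.top_orthogonal_eq_bot, ← span_wedge2_ket, Submodule.mem_orthogonal]
  intro u hu
  induction hu using Submodule.span_induction with
  | zero => simp
  | add x y _ _ hx hy => rw [inner_add_left, hx, hy, add_zero]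
  | smul a x _ hx => rw [inner_smul_left, hx, mul_zero]
  | mem x hx =>
    obtain ⟨p, rfl⟩ := hx
    obtain ⟨a, b⟩ := p
    obtain ⟨k, l⟩ := q
    have anti : ∀ (a b j k : Fin d), (inner ℂ (wedge2 (ket a) (ket b)) (wedge2 (ket j) (ket k)) : ℂ)
        = -inner ℂ (wedge2 (ket a) (ket b)) (wedge2 (ket k) (ket j)) := fun a b j k => by
      rw [wedge2_inner, wedge2_inner]; ring
    have anti' : ∀ (a b j k : Fin d), (inner ℂ (wedge2 (ket a) (ket b)) (wedge2 (ket j) (ket k)) : ℂ)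
        = -inner ℂ (wedge2 (ket b) (ket a)) (wedge2 (ket j) (ket k)) := fun a b j k => by
      rw [wedge2_inner, wedge2_inner]; ring
    rw [inner_sub_right, sub_eq_zero]
    simp only [ContinuousLinearMap.coe_coe, _root_.sum_apply, _root_.smul_apply,
      InnerProductSpace.rankOne_apply, inner_sum, inner_smul_right, one_apply_eq_self]
    have h1 : ∀ x y : Fin d, ∑ z, ∑ w ∈ Finset.Ioi z,
        c * inner ℂ (wedge2 (ket x) (ket y)) (wedge2 (ket z) (ket w)) *
          ((if k = z then (1 : ℂ) else 0) * (if l = w then 1 else 0)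
            - (if k = w then 1 else 0) * (if l = z then 1 else 0))
        = c * inner ℂ (wedge2 (ket x) (ket y)) (wedge2 (ket k) (ket l)) := fun x y =>
      sum_antisymm (fun z w => c * inner ℂ (wedge2 (ket x) (ket y)) (wedge2 (ket z) (ket w)))
        (fun z w => by rw [anti]; ring) k l
    have h2 := sum_antisymm (fun x y => c * inner ℂ (wedge2 (ket x) (ket y)) (wedge2 (ket k) (ket l)))
      (fun x y => by rw [anti']; ring) a b
    rw [← h2]
    refine Finset.sum_congr rfl fun x _ => Finset.sum_congr rfl fun y _ => ?_
    rw [← h1 x y, Finset.sum_mul]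
    refine Finset.sum_congr rfl fun z _ => ?_
    rw [Finset.sum_mul]
    refine Finset.sum_congr rfl fun w _ => ?_
    rw [wedge2_inner z w k l, wedge2_inner a b x y, dl z k, dl w l, dl z l, dl w k]
    ring

end Wedge

end FermiWalk

theorem corollary47 (d : ℕ) [NeZero d] (W : Hil (Fin d) ≃ₗᵢ[ℂ] Hil (Fin d)) (α : ℝ)
    (σ : ℝ) (hσ0 : 0 ≤ σ) (hσ1 : σ ≤ 1)
    (ω : carAlg ℤ →ₗ[ℂ] ℂ) (hω : IsQuasiFree ω ((σ : ℂ) • 1))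
    (ρ : Fock (Fin d) →L[ℂ] Fock (Fin d)) (hρ : IsDensityMatrix ρ)
    (hM : Disjoint (spectrum ℂ (oneStepMatrix W α)) (Metric.sphere (0 : ℂ) 1)) :
    Tendsto (fun t : ℕ => rdm2 W α ω ρ t) atTop
      (𝓝 (compress (opTensor ((σ : ℂ) • 1) ((σ : ℂ) • 1)))) ∧
    compress (opTensor ((σ : ℂ) • 1) ((σ : ℂ) • 1) : Pair d →L[ℂ] Pair d)
      = ((σ ^ 2 : ℝ) : ℂ) • (1 : Wedge2 d →L[ℂ] Wedge2 d) := by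
  have hc : compress (opTensor ((σ : ℂ) • 1) ((σ : ℂ) • 1) : Pair d →L[ℂ] Pair d)
      = ((σ ^ 2 : ℝ) : ℂ) • (1 : Wedge2 d →L[ℂ] Wedge2 d) := by
    rw [opTensor_smul_left, opTensor_smul_right, opTensor_one, smul_smul, compress_smul_one]
    push_cast; rw [sq]
  refine ⟨?_, hc⟩
  have hN := tendsto_star_oneStepMatrix_pow W α hM
  rw [hc, Complex.ofReal_pow, ← sum_rankOne_wedge2]
  unfold rdm2
  exact tendsto_finsetSum _ fun j₁ _ => tendsto_finsetSum _ fun j₂ _ =>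
    tendsto_finsetSum _ fun k₁ _ => tendsto_finsetSum _ fun k₂ _ =>
      (tendsto_rdmEntry hω hρ hN j₁ j₂ k₁ k₂).smul_const _
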